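/- Let $\lambda_0,\lambda_1>0$, $\gamma_0>0$, $\gamma_1=0$ and $a_0,a_1\in\mathbb R$. Let $\varepsilon=\varepsilon(t)$, $t\ge 0$, be the continuous-time Markov chain on $\{0,1\}$ that switches from $0$ to $1$ with intensity $\lambda_0$ and from $1$ to $0$ with intensity $\lambda_1$, and let the Kac--Ornstein--Uhlenbeck process $X$ be the solution of $$X(t)=x+\int_0^t\bigl(a_{\varepsilon(s)}-\gamma_{\varepsilon(s)}X(s)\bigr)\,ds,\qquad t\ge0,$$ that is, $X(t)=xe^{-\Gamma(t)}+\int_0^t a_{\varepsilon(s)}e^{-(\Gamma(t)-\Gamma(s))}\,ds$ with $\Gamma(t)=\int_0^t\gamma_{\varepsilon(s)}\,ds$. A measure $\mu$ on $\mathbb R\times\{0,1\}$ is called invariant if $$\mu(B)=\int \mathbb P\bigl\{(X(t),\varepsilon(t))\in B\mid (X(0),\varepsilon(0))=z\bigr\}\,\mu(dz)$$ for all $t\ge0$ and all Borel sets $B\subset\mathbb R\times\{0,1\}$. A pair $(\pi_0,\pi_1)$ of nonnegative integrable functions on $\mathbb R$ with $\int_{\mathbb R}(\pi_0+\pi_1)\,dx=1$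 is called an invariant probability density if the measure $\mu$ whose restriction to $\mathbb R\times\{i\}$ is $\pi_i(x)\,dx$, $i=0,1$, is invariant. Put $$\rho=\frac{a_0}{\gamma_0},\qquad \alpha=\frac{\lambda_0}{\gamma_0},\qquad C=\frac{\lambda_1^{1+\alpha}}{(\lambda_0+\lambda_1)\Gamma(\alpha)},$$ where in the last formula $\Gamma(\cdot)$ is Euler's Gamma function. (i) If $a_1=1$, then $$\pi_0(x)=C|x-\rho|^{\alpha-1}e^{-\lambda_1|x-\rho|}\mathbf 1_{\{x>\rho\}},\qquad \pi_1(x)=\gamma_0C|x-\rho|^{\alpha}e^{-\lambda_1|x-\rho|}\mathbf 1_{\{x>\rho\}}$$ is an invariant probability density, and it is the only one up to equality almost everywhere. (ii) If $a_1=-1$, the same holds with $\mathbf 1_{\{x>\rho\}}$ replaced by $\mathbf 1_{\{x<\rho\}}$ in both formulas. (iii) If $a_1=0$, there is no invariant probability density; moreover, every invariant probability measure $\mu$ is concentrated on the rest point, $\mu\bigl((\mathbb R\setminus\{\rho\})\times\{0,1\}\bigr)=0$. -/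

import Mathlib

open MeasureTheory ProbabilityTheory
open scoped ENNReal

noncomputable section

namespace KacOU

instance expOneIsProbability : IsProbabilityMeasure (expMeasure 1) :=
  isProbabilityMeasure_expMeasure one_pos

/-- The law of a sequence of independent `Exp(1)` random variables. -/
def clockLaw : Measure (ℕ → ℝ) :=
  Measure.infinitePi fun _ : ℕ => expMeasure 1

/-- The state of the chain after `n` switches, started in state `i`. -/
def stateAfter (i : Fin 2) (n : ℕ) : Fin 2 := i + Fin.ofNat 2 n

/-- The time of the `n`-th switch. The holding time between the `k`-th and the `(k+1)`-st switch
is `ω k / lam j`, with `j` the current state, hence has the law `Exp(lam j)`. -/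
def switchTime (lam : Fin 2 → ℝ) (i : Fin 2) (ω : ℕ → ℝ) (n : ℕ) : ℝ :=
  ∑ k ∈ Finset.range n, ω k / lam (stateAfter i k)

/-- The number of switches up to time `t` (almost surely finite). -/
def switchCount (lam : Fin 2 → ℝ) (i : Fin 2) (ω : ℕ → ℝ) (t : ℝ) : ℕ :=
  Set.ncard {n : ℕ | switchTime lam i ω (n + 1) ≤ t}

/-- The two-state continuous-time Markov chain `ε(t)` started in `i`, with intensity `lam 0` for
the switch from `0` to `1` and `lam 1` for the switch from `1` to `0`. -/
def chain (lam : Fin 2 → ℝ) (i : Fin 2) (ω : ℕ → ℝ) (t : ℝ) : Fin 2 :=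
  stateAfter i (switchCount lam i ω t)

/-- `Γ(t) = ∫₀ᵗ γ_{ε(s)} ds`. -/
def cumRate (lam γ : Fin 2 → ℝ) (i : Fin 2) (ω : ℕ → ℝ) (t : ℝ) : ℝ :=
  ∫ s in (0 : ℝ)..t, γ (chain lam i ω s)

/-- The Kac-Ornstein-Uhlenbeck process started at `x`, with the chain started in `i`:
`X(t) = x e^{-Γ(t)} + ∫₀ᵗ a_{ε(s)} e^{-(Γ(t) - Γ(s))} ds`, which is the unique solution of
`X(t) = x + ∫₀ᵗ (a_{ε(s)} - γ_{ε(s)} X(s)) ds`. -/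
def process (lam a γ : Fin 2 → ℝ) (x : ℝ) (i : Fin 2) (ω : ℕ → ℝ) (t : ℝ) : ℝ :=
  x * Real.exp (-cumRate lam γ i ω t) +
    ∫ s in (0 : ℝ)..t,
      a (chain lam i ω s) * Real.exp (-(cumRate lam γ i ω t - cumRate lam γ i ω s))

/-- The transition function of the Markov process `(X, ε)`: the probability that
`(X(t), ε(t)) ∈ B` when `(X(0), ε(0)) = z`. -/
def transition (lam a γ : Fin 2 → ℝ) (t : ℝ) (z : ℝ × Fin 2) (B : Set (ℝ × Fin 2)) : ℝ≥0∞ :=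
  clockLaw {ω | (process lam a γ z.1 z.2 ω t, chain lam z.2 ω t) ∈ B}

/-- The measure `μ = (μ₀, μ₁)` on `ℝ × {0, 1}` is a fixed point of the adjoint of the transition
semigroup: `μ(B) = ∫ P(t, B | z) μ(dz)`. -/
def IsInvariant (lam a γ : Fin 2 → ℝ) (μ : Measure (ℝ × Fin 2)) : Prop :=
  ∀ t : ℝ, 0 ≤ t → ∀ B : Set (ℝ × Fin 2), MeasurableSet B →
    ∫⁻ z, transition lam a γ t z B ∂μ = μ B

/-- The measure on `ℝ × {0, 1}` whose part on `ℝ × {i}` is `π i x dx`. -/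
def densityMeasure (π : Fin 2 → ℝ → ℝ) : Measure (ℝ × Fin 2) :=
  Measure.sum fun i : Fin 2 =>
    (volume.withDensity fun x => ENNReal.ofReal (π i x)).map fun x => (x, i)

/-- `π = (π₀, π₁)` is an invariant probability density function. -/
structure IsInvariantDensity (lam a γ : Fin 2 → ℝ) (π : Fin 2 → ℝ → ℝ) : Prop where
  nonneg : ∀ i x, 0 ≤ π i x
  integrable : ∀ i, Integrable (π i)
  integral_eq_one : ∫ x, (π 0 x + π 1 x) = 1
  invariant : IsInvariant lam a γ (densityMeasure π)

/-- The constant `C = λ₁^{1+α} / ((λ₀ + λ₁) Γ(α))`. -/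
def normConst (lam : Fin 2 → ℝ) (α : ℝ) : ℝ :=
  lam 1 ^ (1 + α) / ((lam 0 + lam 1) * Real.Gamma α)

/-- The functions `π₀ = C |x-ρ|^{α-1} e^{-λ₁|x-ρ|} 1_K` and
`π₁ = γ₀ C |x-ρ|^α e^{-λ₁|x-ρ|} 1_K`, where `α = λ₀ / γ₀` and `ρ = a₀ / γ₀`. -/
def explicitDensity (lam a γ : Fin 2 → ℝ) (K : Set ℝ) : Fin 2 → ℝ → ℝ :=
  let α := lam 0 / γ 0
  let ρ := a 0 / γ 0
  let C := normConst lam α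
  ![K.indicator fun x => C * |x - ρ| ^ (α - 1) * Real.exp (-lam 1 * |x - ρ|),
    K.indicator fun x => γ 0 * C * |x - ρ| ^ α * Real.exp (-lam 1 * |x - ρ|)]

end KacOU

end

namespace KacOU

open Filter Topology Set

section

/-! ### Paths of the chain and of the process -/

/-! Uniqueness is a coupling. The equation is linear, so two solutions driven by the same clocks
differ by `(x - y) e^{-Γ(t)}` (`process_eq_add`), and `Γ(t) → ∞` almost surely because the chain
spends infinite total time in state `0`, where `γ 0 > 0` (`tendsto_exp_neg_cumRate`). Hence under an
invariant probability measure the limiting law of `(X, ε)` depends only on the law of `ε(0)`. That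
law is the same for all such measures, since the chain alone determines it (`invariant_marginal`).
Comparing characteristic functions on each copy of `ℝ` gives `invariant_unique`. When both velocity
fields vanish at `ρ`, comparison with the constant solution `ρ` gives `|X(n) - ρ| = |X(0) - ρ|
e^{-Γ(n)} → 0`, so a stationary law sits on `ρ` and has no density (`invariant_concentrated`).

Existence goes through resolvents, which avoids generators and their domains. Conditioning on the
first switch expresses the resolvent in state `i` by the deterministic motion killed at rate `lam i`
(`resolvent_eq`). If each part of `μ` satisfies the corresponding balance identity, summing over the
two states gives `q μ R_q f = μ f` for all `q > 0`. By uniqueness of Laplace transforms `μ P_t f = μ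
f` for almost every `t`, and for every `t ≥ 0` by right continuity
(`isInvariant_of_killedResolvent`).

In the distance `y` from `ρ`, measured along the direction of `a 1 = ± 1`, state `0` is the
contraction `y ↦ e^{-γ₀ t} y` and state `1` the translation `y ↦ y + t`. For the explicit profile
each balance identity then reduces to integrating an exact derivative in `t`
(`profile_balance_zero`, `profile_balance_one`); the exponent `α = λ₀ / γ₀` is what makes the powers
match. -/

/-- Clock sequences with positive entries and divergent sum; almost every sequence is one. -/
structure Regular (ω : ℕ → ℝ) : Prop where
  pos : ∀ k, 0 < ω k
  diverges : Tendsto (fun n => ∑ k ∈ Finset.range n, ω k) atTop atTop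

/-- The clock sequence without its first entry. -/
def shift (ω : ℕ → ℝ) : ℕ → ℝ := fun k => ω (k + 1)

lemma Regular.shift {ω : ℕ → ℝ} (h : Regular ω) : Regular (shift ω) := by
  refine ⟨fun k => h.pos (k + 1), ?_⟩
  have h1 := (tendsto_add_atTop_iff_nat 1).2 h.diverges
  simp only [Finset.sum_range_succ'] at h1
  have h2 := tendsto_atTop_add_const_right _ (-ω 0) h1
  simpa [KacOU.shift] using h2

lemma stateAfter_zero (i : Fin 2) : stateAfter i 0 = i := by
  simp [stateAfter]

lemma stateAfter_succ (i : Fin 2) (n : ℕ) : stateAfter i (n + 1) = stateAfter (i + 1) n := by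
  have h : Fin.ofNat 2 (n + 1) = 1 + Fin.ofNat 2 n := by
    ext; simp [Fin.val_add, Nat.add_comm]
  rw [stateAfter, stateAfter, h, add_assoc]

lemma switchTime_succ (lam : Fin 2 → ℝ) (i : Fin 2) (ω : ℕ → ℝ) (n : ℕ) :
    switchTime lam i ω (n + 1) = ω 0 / lam i + switchTime lam (i + 1) (shift ω) n := by
  rw [switchTime, Finset.sum_range_succ', add_comm, stateAfter_zero]
  simp only [stateAfter_succ, switchTime, shift]

variable {lam : Fin 2 → ℝ} {ω : ℕ → ℝ}

lemma switchTime_nonneg (hlam : ∀ i, 0 < lam i) (h : Regular ω) (i : Fin 2) (n : ℕ) :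
    0 ≤ switchTime lam i ω n :=
  Finset.sum_nonneg fun k _ => div_nonneg (h.pos k).le (hlam _).le

lemma tendsto_switchTime (hlam : ∀ i, 0 < lam i) (h : Regular ω) (i : Fin 2) :
    Tendsto (switchTime lam i ω) atTop atTop := by
  have hL : 0 < max (lam 0) (lam 1) := lt_max_of_lt_left (hlam 0)
  refine tendsto_atTop_mono (fun n => ?_) (h.diverges.atTop_div_const hL)
  rw [Finset.sum_div]
  refine Finset.sum_le_sum fun k _ => div_le_div_of_nonneg_left (h.pos k).le (hlam _) ?_
  generalize stateAfter i k = j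
  fin_cases j <;> simp

/-- Divergence of the clocks makes `Set.ncard` in `switchCount` a genuine count; on an infinite set
it would be `0`. -/
lemma finite_switchTime_le (hlam : ∀ i, 0 < lam i) (h : Regular ω) (i : Fin 2) (t : ℝ) :
    {n : ℕ | switchTime lam i ω (n + 1) ≤ t}.Finite := by
  have h1 := ((tendsto_add_atTop_iff_nat 1).2 (tendsto_switchTime hlam h i)).eventually_gt_atTop t
  rw [← Nat.cofinite_eq_atTop, eventually_cofinite] at h1
  simpa using h1

lemma switchCount_of_lt (hlam : ∀ i, 0 < lam i) (h : Regular ω) {i : Fin 2} {t : ℝ}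
    (ht : t < ω 0 / lam i) : switchCount lam i ω t = 0 := by
  have : {n : ℕ | switchTime lam i ω (n + 1) ≤ t} = ∅ := by
    refine eq_empty_of_forall_notMem fun n hn => ?_
    have hn' : switchTime lam i ω (n + 1) ≤ t := hn
    rw [switchTime_succ] at hn'
    linarith [switchTime_nonneg hlam h.shift (i + 1) n]
  rw [switchCount, this, ncard_empty]

/-- Pathwise renewal: after the first switch, the path is the one started in the other state with
the shifted clocks. The `+ 1` is the first switch itself. -/
lemma switchCount_of_ge (hlam : ∀ i, 0 < lam i) (h : Regular ω) {i : Fin 2} {t : ℝ}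
    (ht : ω 0 / lam i ≤ t) :
    switchCount lam i ω t = switchCount lam (i + 1) (shift ω) (t - ω 0 / lam i) + 1 := by
  have : {n : ℕ | switchTime lam i ω (n + 1) ≤ t} =
      insert 0 (Nat.succ ''
        {n : ℕ | switchTime lam (i + 1) (shift ω) (n + 1) ≤ t - ω 0 / lam i}) := by
    ext n
    rcases n with _ | n
    · simp [switchTime, stateAfter_zero, ht]
    · simp only [mem_ofPred_eq, switchTime_succ lam i, mem_insert_iff, Nat.succ_ne_zero,
        mem_image, false_or, Nat.succ_eq_add_one, Nat.add_right_cancel_iff, exists_eq_right]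
      constructor <;> intro h <;> linarith
  rw [switchCount, this, ncard_insert_of_notMem (by simp)
    ((finite_switchTime_le hlam h.shift _ _).image _),
    ncard_image_of_injective _ Nat.succ_injective, switchCount]

lemma chain_of_lt (hlam : ∀ i, 0 < lam i) (h : Regular ω) {i : Fin 2} {t : ℝ}
    (ht : t < ω 0 / lam i) : chain lam i ω t = i := by
  rw [chain, switchCount_of_lt hlam h ht, stateAfter_zero]

lemma chain_of_ge (hlam : ∀ i, 0 < lam i) (h : Regular ω) {i : Fin 2} {t : ℝ}
    (ht : ω 0 / lam i ≤ t) :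
    chain lam i ω t = chain lam (i + 1) (shift ω) (t - ω 0 / lam i) := by
  rw [chain, switchCount_of_ge hlam h ht, stateAfter_succ, chain]

/-- Right continuity: only finitely many switch times lie below `t + 1`, and a switch at `t` itself
is already counted at `t`, so no comparison changes just to the right of `t`. -/
lemma chain_eventually_eq (hlam : ∀ i, 0 < lam i) (h : Regular ω) (i : Fin 2) (t : ℝ) :
    ∀ᶠ s in 𝓝[≥] t, chain lam i ω s = chain lam i ω t := by
  have hF := finite_switchTime_le hlam h i (t + 1)
  have h1 : ∀ n ∈ {n : ℕ | switchTime lam i ω (n + 1) ≤ t + 1}, ∀ᶠ s in 𝓝[≥] t,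
      (switchTime lam i ω (n + 1) ≤ s ↔ switchTime lam i ω (n + 1) ≤ t) := by
    intro n _
    by_cases hn : switchTime lam i ω (n + 1) ≤ t
    · filter_upwards [self_mem_nhdsWithin] with s hs
      exact iff_of_true (hn.trans hs) hn
    · filter_upwards [nhdsWithin_le_nhds (Iio_mem_nhds (not_le.1 hn))] with s hs
      exact iff_of_false (not_le.2 hs) hn
  have h2 := (eventually_all_finite hF).2 h1
  have h3 : ∀ᶠ s in 𝓝[≥] t, s < t + 1 :=
    nhdsWithin_le_nhds (Iio_mem_nhds (lt_add_one t))
  filter_upwards [h2, h3] with s hs hs1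
  have : {n : ℕ | switchTime lam i ω (n + 1) ≤ s} = {n : ℕ | switchTime lam i ω (n + 1) ≤ t} := by
    ext n
    by_cases hn : switchTime lam i ω (n + 1) ≤ t + 1
    · exact hs n hn
    · refine iff_of_false (fun h => hn (le_trans h hs1.le)) (fun h => hn (le_trans h ?_))
      linarith
  rw [chain, chain, switchCount, switchCount, this]

lemma measurable_of_countable_level {α : Type*} [MeasurableSpace α] {S : α → Set ℕ}
    (hS : ∀ n, MeasurableSet {x | n ∈ S x}) : Measurable fun x => (S x).ncard := by
  have h1 : ∀ s : Finset ℕ, MeasurableSet {x | S x = (s : Set ℕ)} := by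
    intro s
    have : {x | S x = (s : Set ℕ)} = ⋂ n, {x | n ∈ S x ↔ n ∈ s} := by
      ext x; simp [Set.ext_iff]
    rw [this]
    refine MeasurableSet.iInter fun n => ?_
    by_cases hn : n ∈ s
    · simpa only [hn, iff_true] using hS n
    · simp only [hn, iff_false]
      exact (hS n).compl
  refine measurable_to_countable' fun m => ?_
  have : (fun x => (S x).ncard) ⁻¹' {m} =
      (⋃ s : {s : Finset ℕ // s.card = m}, {x | S x = ((s : Finset ℕ) : Set ℕ)}) ∪
        -- `ncard` is also `0` on infinite sets, so the level `0` contains the event that `S x` is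
        -- infinite.
        (if m = 0 then (⋃ s : Finset ℕ, {x | S x = (s : Set ℕ)})ᶜ else ∅) := by
    ext x
    by_cases hf : (S x).Finite
    · obtain ⟨s, hs⟩ := hf.exists_finset_coe
      rcases eq_or_ne m 0 with hm | hm <;> simp [← hs, hm]
    · have hx : ∀ s : Finset ℕ, S x ≠ (s : Set ℕ) := fun s hs => hf (hs ▸ s.finite_toSet)
      have h0 : (S x).ncard = 0 := Set.Infinite.ncard hf
      rcases eq_or_ne m 0 with hm | hm
      · simp [hx, hm, h0]
      · simp [hx, hm, h0, hm.symm]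
  rw [this]
  refine MeasurableSet.union (MeasurableSet.iUnion fun s => h1 _) ?_
  split_ifs
  · exact (MeasurableSet.iUnion fun s => h1 _).compl
  · exact MeasurableSet.empty

lemma measurable_switchTime (lam : Fin 2 → ℝ) (i : Fin 2) (n : ℕ) :
    Measurable fun ω : ℕ → ℝ => switchTime lam i ω n := by
  unfold switchTime
  fun_prop

lemma measurable_chain (lam : Fin 2 → ℝ) (i : Fin 2) :
    Measurable fun p : (ℕ → ℝ) × ℝ => chain lam i p.1 p.2 := by
  have h1 : Measurable fun p : (ℕ → ℝ) × ℝ => switchCount lam i p.1 p.2 := by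
    refine measurable_of_countable_level fun n => ?_
    exact measurableSet_le ((measurable_switchTime lam i (n + 1)).comp measurable_fst)
      measurable_snd
  exact (measurable_from_top (f := stateAfter i)).comp h1

lemma measurable_chain_time (lam : Fin 2 → ℝ) (i : Fin 2) (ω : ℕ → ℝ) :
    Measurable fun t : ℝ => chain lam i ω t :=
  (measurable_chain lam i).comp (g := fun p : (ℕ → ℝ) × ℝ => chain lam i p.1 p.2)
    (f := fun t : ℝ => (ω, t)) measurable_prodMk_left

lemma intervalIntegrable_chain (lam : Fin 2 → ℝ) (c : Fin 2 → ℝ) (i : Fin 2) (ω : ℕ → ℝ)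
    (u v : ℝ) : IntervalIntegrable (fun s => c (chain lam i ω s)) volume u v := by
  have hm : Measurable fun s : ℝ => c (chain lam i ω s) :=
    (measurable_of_finite c).comp (measurable_chain_time lam i ω)
  refine (intervalIntegrable_const (c := |c 0| + |c 1|)).mono_fun hm.aestronglyMeasurable
    (Eventually.of_forall fun s => ?_)
  show ‖c (chain lam i ω s)‖ ≤ ‖|c 0| + |c 1|‖
  refine le_trans ?_ (le_abs_self _)
  generalize chain lam i ω s = j
  fin_cases j <;> simp

lemma continuous_cumRate (lam γ : Fin 2 → ℝ) (i : Fin 2) (ω : ℕ → ℝ) :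
    Continuous (cumRate lam γ i ω) :=
  intervalIntegral.continuous_primitive (fun u v => intervalIntegrable_chain lam γ i ω u v) 0

lemma cumRate_mono {γ : Fin 2 → ℝ} (hγ : ∀ i, 0 ≤ γ i) (i : Fin 2) (ω : ℕ → ℝ) :
    Monotone (cumRate lam γ i ω) := by
  intro s t hst
  have := intervalIntegral.integral_interval_sub_left
    (intervalIntegrable_chain lam γ i ω 0 t) (intervalIntegrable_chain lam γ i ω 0 s)
  have h2 : 0 ≤ ∫ r in s..t, γ (chain lam i ω r) :=
    intervalIntegral.integral_nonneg hst fun r _ => hγ _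
  simp only [cumRate]
  linarith

/-- The switch time itself is allowed: the integral does not see the endpoint, where the chain has
already jumped. -/
lemma cumRate_of_le (hlam : ∀ i, 0 < lam i) (h : Regular ω) (γ : Fin 2 → ℝ) {i : Fin 2} {t : ℝ}
    (ht0 : 0 ≤ t) (ht : t ≤ ω 0 / lam i) : cumRate lam γ i ω t = γ i * t := by
  have : ∫ s in (0 : ℝ)..t, γ (chain lam i ω s) = ∫ s in (0 : ℝ)..t, γ i := by
    refine intervalIntegral.integral_congr_Ioo_of_le ht0 fun s hs => ?_
    simp only [chain_of_lt hlam h (hs.2.trans_le ht)]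
  rw [cumRate, this]
  simp [mul_comm]

lemma cumRate_of_ge (hlam : ∀ i, 0 < lam i) (h : Regular ω) (γ : Fin 2 → ℝ) {i : Fin 2} {t : ℝ}
    (ht : ω 0 / lam i ≤ t) :
    cumRate lam γ i ω t = γ i * (ω 0 / lam i) +
      cumRate lam γ (i + 1) (shift ω) (t - ω 0 / lam i) := by
  set τ := ω 0 / lam i with hτ
  have hτ0 : 0 ≤ τ := (div_pos (h.pos 0) (hlam i)).le
  have h1 : ∫ s in τ..t, γ (chain lam i ω s) =
      ∫ s in τ..t, γ (chain lam (i + 1) (shift ω) (s - τ)) := by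
    refine intervalIntegral.integral_congr_Ioo_of_le ht fun s hs => ?_
    simp only [chain_of_ge hlam h (i := i) (t := s) hs.1.le]
    rfl
  rw [← cumRate_of_le hlam h γ hτ0 le_rfl, cumRate, cumRate, cumRate,
    ← intervalIntegral.integral_add_adjacent_intervals
      (intervalIntegrable_chain lam γ i ω 0 τ) (intervalIntegrable_chain lam γ i ω τ t), h1,
    intervalIntegral.integral_comp_sub_right (fun s => γ (chain lam (i + 1) (shift ω) s)) τ,
    sub_self]

/-- The solution at time `t` of the linear equation `X' = a i - γ i X`, `X 0 = x`. -/
noncomputable def flow (a γ : Fin 2 → ℝ) (i : Fin 2) (t x : ℝ) : ℝ :=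
  x * Real.exp (-(γ i * t)) + ∫ s in (0 : ℝ)..t, a i * Real.exp (-(γ i * t - γ i * s))

lemma intervalIntegrable_chain_mul (lam c : Fin 2 → ℝ) (i : Fin 2) (ω : ℕ → ℝ) {g : ℝ → ℝ}
    (hg : Continuous g) (u v : ℝ) :
    IntervalIntegrable (fun s => c (chain lam i ω s) * g s) volume u v :=
  (intervalIntegrable_chain lam c i ω u v).mul_continuousOn hg.continuousOn

lemma process_of_le (hlam : ∀ i, 0 < lam i) (h : Regular ω) (a γ : Fin 2 → ℝ) (x : ℝ)
    {i : Fin 2} {t : ℝ} (ht0 : 0 ≤ t) (ht : t ≤ ω 0 / lam i) :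
    process lam a γ x i ω t = flow a γ i t x := by
  rw [process, flow, cumRate_of_le hlam h γ ht0 ht]
  congr 1
  refine intervalIntegral.integral_congr_Ioo_of_le ht0 fun s hs => ?_
  simp only [chain_of_lt hlam h (hs.2.trans_le ht),
    cumRate_of_le hlam h γ hs.1.le (hs.2.le.trans ht)]

/-- `Γ` is additive at the first switch. The part of the integral before it is therefore that of
`flow`, damped by the later factor `e^{-Γ}`; the part after it is the new process's integral,
translated in time. -/
lemma process_of_ge (hlam : ∀ i, 0 < lam i) (h : Regular ω) (a γ : Fin 2 → ℝ) (x : ℝ)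
    {i : Fin 2} {t : ℝ} (ht : ω 0 / lam i ≤ t) :
    process lam a γ x i ω t =
      process lam a γ (flow a γ i (ω 0 / lam i) x) (i + 1) (shift ω) (t - ω 0 / lam i) := by
  have hG := cumRate_of_ge hlam h γ ht
  have hτ0 : 0 ≤ ω 0 / lam i := (div_pos (h.pos 0) (hlam i)).le
  have hcont : Continuous fun s => Real.exp (-(cumRate lam γ i ω t - cumRate lam γ i ω s)) := by
    have := continuous_cumRate lam γ i ω
    fun_prop
  rw [process, process, flow, ← intervalIntegral.integral_add_adjacent_intervals
    (intervalIntegrable_chain_mul lam a i ω hcont 0 (ω 0 / lam i))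
    (intervalIntegrable_chain_mul lam a i ω hcont (ω 0 / lam i) t)]
  have h1 : ∫ s in (0 : ℝ)..(ω 0 / lam i), a (chain lam i ω s) *
        Real.exp (-(cumRate lam γ i ω t - cumRate lam γ i ω s)) =
      (∫ s in (0 : ℝ)..(ω 0 / lam i), a i * Real.exp (-(γ i * (ω 0 / lam i) - γ i * s))) *
        Real.exp (-cumRate lam γ (i + 1) (shift ω) (t - ω 0 / lam i)) := by
    rw [← intervalIntegral.integral_mul_const]
    refine intervalIntegral.integral_congr_Ioo_of_le hτ0 fun s hs => ?_
    simp only [chain_of_lt hlam h hs.2, cumRate_of_le hlam h γ hs.1.le hs.2.le, hG]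
    rw [mul_assoc, ← Real.exp_add]
    congr 2
    ring
  have h2 : ∫ s in (ω 0 / lam i)..t, a (chain lam i ω s) *
        Real.exp (-(cumRate lam γ i ω t - cumRate lam γ i ω s)) =
      ∫ s in (0 : ℝ)..(t - ω 0 / lam i), a (chain lam (i + 1) (shift ω) s) *
        Real.exp (-(cumRate lam γ (i + 1) (shift ω) (t - ω 0 / lam i) -
          cumRate lam γ (i + 1) (shift ω) s)) := by
    have h3 := intervalIntegral.integral_comp_sub_right (a := ω 0 / lam i) (b := t)
      (fun s => a (chain lam (i + 1) (shift ω) s) *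
        Real.exp (-(cumRate lam γ (i + 1) (shift ω) (t - ω 0 / lam i) -
          cumRate lam γ (i + 1) (shift ω) s))) (ω 0 / lam i)
    rw [sub_self] at h3
    rw [← h3]
    refine intervalIntegral.integral_congr_Ioo_of_le ht fun s hs => ?_
    simp only [chain_of_ge hlam h hs.1.le, cumRate_of_ge hlam h γ hs.1.le, hG]
    congr 2
    ring
  rw [h1, h2, hG, neg_add, Real.exp_add]
  ring

lemma process_eq_exp_mul (lam a γ : Fin 2 → ℝ) (x : ℝ) (i : Fin 2) (ω : ℕ → ℝ) (t : ℝ) :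
    process lam a γ x i ω t = Real.exp (-cumRate lam γ i ω t) *
      (x + ∫ s in (0 : ℝ)..t, a (chain lam i ω s) * Real.exp (cumRate lam γ i ω s)) := by
  rw [process, mul_add, ← intervalIntegral.integral_const_mul, mul_comm x]
  congr 2
  ext s
  rw [neg_sub, sub_eq_neg_add, Real.exp_add]
  ring

lemma continuous_process (lam a γ : Fin 2 → ℝ) (x : ℝ) (i : Fin 2) (ω : ℕ → ℝ) :
    Continuous (process lam a γ x i ω) := by
  have hG := continuous_cumRate lam γ i ω
  have h1 : Continuous fun t => ∫ s in (0 : ℝ)..t,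
      a (chain lam i ω s) * Real.exp (cumRate lam γ i ω s) :=
    intervalIntegral.continuous_primitive
      (fun u v => intervalIntegrable_chain_mul lam a i ω (Real.continuous_exp.comp hG) u v) 0
  simp only [funext (process_eq_exp_mul lam a γ x i ω)]
  fun_prop

/-- The coupling: neither `Γ` nor the forcing term depends on the starting point. -/
lemma process_eq_add (lam a γ : Fin 2 → ℝ) (x y : ℝ) (i : Fin 2) (ω : ℕ → ℝ) (t : ℝ) :
    process lam a γ x i ω t =
      process lam a γ y i ω t + (x - y) * Real.exp (-cumRate lam γ i ω t) := by
  simp only [process]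
  ring

/-- If `ρ` is a zero of both velocity fields, the process started at `ρ` stays there. -/
lemma process_rest (hlam : ∀ i, 0 < lam i) (h : Regular ω) {a γ : Fin 2 → ℝ} {ρ : ℝ}
    (ha : ∀ i, a i = γ i * ρ) (i : Fin 2) (t : ℝ) :
    process lam a γ ρ i ω t = ρ := by
  have hG := continuous_cumRate lam γ i ω
  have hint : ∀ u v, IntervalIntegrable
      (fun s => γ (chain lam i ω s) * Real.exp (cumRate lam γ i ω s)) volume u v :=
    fun u v => intervalIntegrable_chain_mul lam γ i ω (Real.continuous_exp.comp hG) u v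
  -- `e^Γ` has corners at the switches, so only its right derivative is available; right continuity
  -- of the chain supplies it.
  have hder : ∀ s ∈ Ioo (min 0 t) (max 0 t), HasDerivWithinAt
      (fun s => Real.exp (cumRate lam γ i ω s))
      (γ (chain lam i ω s) * Real.exp (cumRate lam γ i ω s)) (Ioi s) s := by
    intro s _
    have hc : ContinuousWithinAt (fun r => γ (chain lam i ω r)) (Ioi s) s := by
      refine ContinuousWithinAt.mono (t := Ici s) ?_ Ioi_subset_Ici_self
      refine tendsto_const_nhds.congr' ?_
      filter_upwards [chain_eventually_eq hlam h i s] with r hr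
      rw [hr]
    have hm : Measurable fun s : ℝ => γ (chain lam i ω s) :=
      (measurable_of_finite γ).comp (measurable_chain_time lam i ω)
    have := intervalIntegral.integral_hasDerivWithinAt_right
      (intervalIntegrable_chain lam γ i ω 0 s) (s := Ici s) (t := Ioi s)
      hm.stronglyMeasurable.stronglyMeasurableAtFilter hc
    have h2 := (this.mono Ioi_subset_Ici_self).exp
    rwa [mul_comm] at h2
  have key := intervalIntegral.integral_eq_sub_of_hasDeriv_right
    (Real.continuous_exp.comp hG).continuousOn hder (hint 0 t)
  have h0 : cumRate lam γ i ω 0 = 0 := by simp [cumRate]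
  rw [process_eq_exp_mul]
  have h1 : ∫ s in (0 : ℝ)..t, a (chain lam i ω s) * Real.exp (cumRate lam γ i ω s) =
      ρ * ∫ s in (0 : ℝ)..t, γ (chain lam i ω s) * Real.exp (cumRate lam γ i ω s) := by
    rw [← intervalIntegral.integral_const_mul]
    congr 1
    ext s
    rw [ha]
    ring
  rw [h1, key]
  simp only [Function.comp, h0, Real.exp_zero]
  rw [Real.exp_neg]
  field_simp
  ring

end

section

/-! ### Measurability -/

/-- The variable endpoint is absorbed into the indicator of a measurable region of the product;
there are two regions because the integral is oriented. -/
lemma measurable_integral_zero {α : Type*} [MeasurableSpace α] {f : α × ℝ → ℝ}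
    (hf : Measurable f) {g : α → ℝ} (hg : Measurable g) :
    Measurable fun p => ∫ s in (0 : ℝ)..g p, f (p, s) := by
  have key : ∀ {D : Set (α × ℝ)}, MeasurableSet D →
      Measurable fun p => ∫ s, D.indicator f (p, s) := fun hD =>
    (hf.indicator hD).stronglyMeasurable.integral_prod_right'.measurable
  have h1 : MeasurableSet {q : α × ℝ | 0 < q.2 ∧ q.2 ≤ g q.1} :=
    (measurableSet_lt measurable_const measurable_snd).inter
      (measurableSet_le measurable_snd (hg.comp measurable_fst))
  have h2 : MeasurableSet {q : α × ℝ | g q.1 < q.2 ∧ q.2 ≤ 0} :=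
    (measurableSet_lt (hg.comp measurable_fst) measurable_snd).inter
      (measurableSet_le measurable_snd measurable_const)
  convert (key h1).sub (key h2) using 1
  ext p
  rw [intervalIntegral, ← integral_indicator measurableSet_Ioc,
    ← integral_indicator measurableSet_Ioc]
  rfl

variable (lam a γ : Fin 2 → ℝ)

lemma measurable_cumRate (i : Fin 2) :
    Measurable fun p : (ℕ → ℝ) × ℝ => cumRate lam γ i p.1 p.2 := by
  have h1 : Measurable fun q : ((ℕ → ℝ) × ℝ) × ℝ => γ (chain lam i q.1.1 q.2) :=
    (measurable_of_finite γ).comp ((measurable_chain lam i).comp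
      (f := fun q : ((ℕ → ℝ) × ℝ) × ℝ => (q.1.1, q.2)) (by fun_prop))
  exact measurable_integral_zero h1 measurable_snd

lemma measurable_process (i : Fin 2) :
    Measurable fun p : (ℝ × ℝ) × (ℕ → ℝ) => process lam a γ p.1.2 i p.2 p.1.1 := by
  have hG := measurable_cumRate lam γ i
  have h1 : Measurable fun q : ((ℝ × ℝ) × (ℕ → ℝ)) × ℝ => a (chain lam i q.1.2 q.2) :=
    (measurable_of_finite a).comp ((measurable_chain lam i).comp
      (f := fun q : ((ℝ × ℝ) × (ℕ → ℝ)) × ℝ => (q.1.2, q.2)) (by fun_prop))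
  have h2 : Measurable fun q : ((ℝ × ℝ) × (ℕ → ℝ)) × ℝ => cumRate lam γ i q.1.2 q.2 :=
    hG.comp (f := fun q : ((ℝ × ℝ) × (ℕ → ℝ)) × ℝ => (q.1.2, q.2)) (by fun_prop)
  have h3 : Measurable fun q : (ℝ × ℝ) × (ℕ → ℝ) => cumRate lam γ i q.2 q.1.1 :=
    hG.comp (f := fun q : (ℝ × ℝ) × (ℕ → ℝ) => (q.2, q.1.1)) (by fun_prop)
  have h4 : Measurable fun q : ((ℝ × ℝ) × (ℕ → ℝ)) × ℝ => a (chain lam i q.1.2 q.2) *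
      Real.exp (-(cumRate lam γ i q.1.2 q.1.1.1 - cumRate lam γ i q.1.2 q.2)) :=
    h1.mul (((h3.comp measurable_fst).sub h2).neg.exp)
  have h5 := measurable_integral_zero h4 (g := fun q => q.1.1) (by fun_prop)
  exact ((measurable_snd.comp measurable_fst).mul h3.neg.exp).add h5

/-- The state of `(X, ε)` at time `t`, as a function of `(X(0), ε(0))` and the clocks. -/
noncomputable def stateAt (t : ℝ) (p : (ℝ × Fin 2) × (ℕ → ℝ)) : ℝ × Fin 2 :=
  (process lam a γ p.1.1 p.1.2 p.2 t, chain lam p.1.2 p.2 t)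

lemma measurable_stateAt_time :
    Measurable fun p : ℝ × ((ℝ × Fin 2) × (ℕ → ℝ)) => stateAt lam a γ p.1 p.2 := by
  have h : ∀ i : Fin 2, Measurable fun q : (ℝ × ℝ) × (ℕ → ℝ) =>
      stateAt lam a γ q.1.1 ((q.1.2, i), q.2) := fun i =>
    (measurable_process lam a γ i).prodMk ((measurable_chain lam i).comp
      (f := fun q : (ℝ × ℝ) × (ℕ → ℝ) => (q.2, q.1.1)) (by fun_prop))
  have h2 : Measurable fun q : Fin 2 × ((ℝ × ℝ) × (ℕ → ℝ)) =>
      stateAt lam a γ q.2.1.1 ((q.2.1.2, q.1), q.2.2) :=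
    measurable_from_prod_countable_right h
  exact h2.comp (f := fun p : ℝ × ((ℝ × Fin 2) × (ℕ → ℝ)) => (p.2.1.2, ((p.1, p.2.1.1), p.2.2)))
    (by fun_prop)

lemma measurable_stateAt (t : ℝ) : Measurable (stateAt lam a γ t) :=
  (measurable_stateAt_time lam a γ).comp (g := fun p : ℝ × ((ℝ × Fin 2) × (ℕ → ℝ)) =>
    stateAt lam a γ p.1 p.2) (f := fun p => (t, p)) measurable_prodMk_left

instance : IsProbabilityMeasure clockLaw := by
  unfold clockLaw; infer_instance

variable {lam a γ}

/-- Invariance of `μ` says that `(X(t), ε(t))` has law `μ` when `(X(0), ε(0))` has. -/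
lemma isInvariant_iff {μ : Measure (ℝ × Fin 2)} [SFinite μ] : IsInvariant lam a γ μ ↔
    ∀ t, 0 ≤ t → (μ.prod clockLaw).map (stateAt lam a γ t) = μ := by
  have key : ∀ t, ∀ B : Set (ℝ × Fin 2), MeasurableSet B →
      (μ.prod clockLaw).map (stateAt lam a γ t) B = ∫⁻ z, transition lam a γ t z B ∂μ := by
    intro t B hB
    rw [Measure.map_apply (measurable_stateAt lam a γ t) hB,
      Measure.prod_apply (measurable_stateAt lam a γ t hB)]
    rfl
  constructor
  · intro h t ht
    ext B hB
    rw [key t B hB, h t ht B hB]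
  · intro h t ht B hB
    rw [← key t B hB, h t ht]

/-! ### The clocks -/

lemma measurable_shift : Measurable shift := by
  unfold shift; fun_prop

/-- A product measure is determined by finite boxes. Filling a box with `univ` up to an initial
segment of indices lets it split at coordinate `0`. -/
lemma map_cons_clockLaw :
    ((expMeasure 1).prod clockLaw).map
      (fun p : ℝ × (ℕ → ℝ) => fun n : ℕ => Nat.casesOn (motive := fun _ => ℝ) n p.1 p.2)
      = clockLaw := by
  have hm : Measurable
      (fun p : ℝ × (ℕ → ℝ) => fun n : ℕ => Nat.casesOn (motive := fun _ => ℝ) n p.1 p.2) := by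
    refine measurable_pi_lambda _ fun n => ?_
    rcases n with _ | n
    · exact measurable_fst
    · exact (measurable_pi_apply n).comp measurable_snd
  refine Measure.eq_infinitePi _ fun s t ht => ?_
  classical
  obtain ⟨N, hN⟩ : ∃ N, s ⊆ Finset.range (N + 1) := by
    refine ⟨s.sup id, fun k hk => Finset.mem_range_succ_iff.2 (Finset.le_sup (f := id) hk)⟩
  set t' : ℕ → Set ℝ := fun k => if k ∈ s then t k else univ with ht'
  have ht'm : ∀ k, MeasurableSet (t' k) := by
    intro k
    simp only [ht']
    split_ifs
    exacts [ht k, MeasurableSet.univ]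
  have hpi : Set.pi (s : Set ℕ) t = Set.pi (Finset.range (N + 1) : Set ℕ) t' := by
    ext ω
    simp only [Set.mem_pi, ht', Finset.mem_coe]
    constructor
    · intro h k _
      split_ifs with hk
      exacts [h k hk, mem_univ _]
    · intro h k hk
      simpa [hk] using h k (hN hk)
  have hprod : ∏ k ∈ s, expMeasure 1 (t k) = ∏ k ∈ Finset.range (N + 1), expMeasure 1 (t' k) := by
    rw [← Finset.prod_subset hN]
    · exact Finset.prod_congr rfl fun k hk => by simp [ht', hk]
    · intro k _ hk
      simp [ht', hk]
  have hpre : (fun p : ℝ × (ℕ → ℝ) => fun n : ℕ =>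
      Nat.casesOn (motive := fun _ => ℝ) n p.1 p.2) ⁻¹'
        Set.pi (Finset.range (N + 1) : Set ℕ) t' =
      t' 0 ×ˢ Set.pi (Finset.range N : Set ℕ) fun k => t' (k + 1) := by
    ext p
    simp only [Set.mem_preimage, Set.mem_pi, Finset.mem_coe, Finset.mem_range, Set.mem_prod]
    constructor
    · exact fun h => ⟨h 0 (by omega), fun k hk => h (k + 1) (by omega)⟩
    · rintro ⟨h0, h1⟩ k hk
      rcases k with _ | k
      exacts [h0, h1 k (by omega)]
  rw [hpi, hprod, Measure.map_apply hm (MeasurableSet.pi (Finset.countable_toSet _)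
    fun k _ => ht'm k), hpre, Measure.prod_prod, clockLaw,
    Measure.infinitePi_pi _ (fun k _ => ht'm (k + 1)), Finset.prod_range_succ', mul_comm]

/-- The first clock and the remaining ones are independent, and the latter have the law of the
whole sequence. -/
lemma measurePreserving_head_shift :
    MeasurePreserving (fun ω : ℕ → ℝ => (ω 0, shift ω)) clockLaw
      ((expMeasure 1).prod clockLaw) := by
  have hm : Measurable (fun ω : ℕ → ℝ => (ω 0, shift ω)) :=
    (measurable_pi_apply 0).prodMk measurable_shift
  have hm' : Measurable
      (fun p : ℝ × (ℕ → ℝ) => fun n : ℕ => Nat.casesOn (motive := fun _ => ℝ) n p.1 p.2) := by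
    refine measurable_pi_lambda _ fun n => ?_
    rcases n with _ | n
    · exact measurable_fst
    · exact (measurable_pi_apply n).comp measurable_snd
  refine ⟨hm, ?_⟩
  -- Splitting off the head undoes prepending it, so the composed map is the identity.
  conv_lhs => rw [← map_cons_clockLaw]
  rw [Measure.map_map hm hm']
  exact Measure.map_id

lemma lintegral_clockLaw {G : ℝ × (ℕ → ℝ) → ℝ≥0∞} (hG : Measurable G) :
    ∫⁻ ω, G (ω 0, shift ω) ∂clockLaw = ∫⁻ u, ∫⁻ ω, G (u, ω) ∂clockLaw ∂expMeasure 1 := by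
  rw [measurePreserving_head_shift.lintegral_comp hG, lintegral_prod _ hG.aemeasurable]

lemma lintegral_expMeasure {F : ℝ → ℝ≥0∞} (hF : Measurable F) :
    ∫⁻ u, F u ∂expMeasure 1 = ∫⁻ u in Ioi 0, ENNReal.ofReal (Real.exp (-u)) * F u := by
  have h1 : expMeasure 1 = volume.withDensity (gammaPDF 1 1) := rfl
  have h2 : Measurable (gammaPDF 1 1) := (measurable_gammaPDFReal 1 1).ennreal_ofReal
  rw [h1, lintegral_withDensity_eq_lintegral_mul _ h2 hF, ← lintegral_indicator measurableSet_Ioi]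
  refine lintegral_congr_ae ?_
  have h0 : ∀ᵐ u : ℝ, u ≠ 0 := by simp [ae_iff]
  filter_upwards [h0] with u hu
  rcases lt_or_gt_of_ne hu with hu | hu
  · simp [gammaPDF_of_neg hu, hu.le]
  · simp [gammaPDF_of_nonneg hu.le, hu]

lemma lintegral_expMeasure_div {c : ℝ} (hc : 0 < c) {F : ℝ → ℝ≥0∞} (hF : Measurable F) :
    ∫⁻ u, F (u / c) ∂expMeasure 1 =
      ∫⁻ s in Ioi 0, ENNReal.ofReal (c * Real.exp (-(c * s))) * F s := by
  rw [lintegral_expMeasure (by fun_prop), ← lintegral_indicator measurableSet_Ioi]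
  conv_lhs => rw [← Real.smul_map_volume_mul_left hc.ne']
  rw [lintegral_smul_measure, lintegral_map (by measurability) (by fun_prop),
    ← lintegral_indicator measurableSet_Ioi, smul_eq_mul, ← lintegral_const_mul _ (by measurability)]
  refine lintegral_congr fun s => ?_
  by_cases hs : 0 < s
  · have h1 : (0:ℝ) < c * s := mul_pos hc hs
    rw [indicator_of_mem (mem_Ioi.2 h1), indicator_of_mem (mem_Ioi.2 hs), abs_of_pos hc,
      ENNReal.ofReal_mul hc.le, mul_assoc, mul_div_cancel_left₀ _ hc.ne']
  · have h1 : ¬ (0:ℝ) < c * s := fun h => hs ((mul_pos_iff_of_pos_left hc).1 h)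
    rw [indicator_of_notMem (by simpa using h1), indicator_of_notMem (by simpa using hs), mul_zero]

/-! ### Almost sure divergence of the clocks and of `Γ` -/

lemma ae_expMeasure_pos : ∀ᵐ u ∂expMeasure 1, 0 < u := by
  rw [ae_iff]
  have h0 : {u : ℝ | ¬ 0 < u} = Iic 0 := by ext; simp
  rw [h0, ← lintegral_indicator_one measurableSet_Iic,
    lintegral_expMeasure (measurable_one.indicator measurableSet_Iic),
    setLIntegral_congr_fun (g := fun _ => 0) measurableSet_Ioi]
  · simp
  · intro u hu
    have : u ∉ Iic (0 : ℝ) := fun h => not_le.2 (mem_Ioi.1 hu) (mem_Iic.1 h)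
    simp [this]

/-- The Laplace transform of the exponential law is less than one. -/
lemma lintegral_exp_neg_lt_one {c : ℝ} (hc : 0 < c) :
    ∫⁻ u, ENNReal.ofReal (Real.exp (-(c * u))) ∂expMeasure 1 < 1 := by
  have hlt : ∀ᵐ u ∂expMeasure 1, ENNReal.ofReal (Real.exp (-(c * u))) < 1 := by
    filter_upwards [ae_expMeasure_pos] with u hu
    rw [← ENNReal.ofReal_one, ENNReal.ofReal_lt_ofReal_iff one_pos, Real.exp_lt_one_iff]
    nlinarith [mul_pos hc hu]
  have h1 : ∫⁻ _, (1 : ℝ≥0∞) ∂expMeasure 1 = 1 := by simp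
  have h2 : ∫⁻ u, ENNReal.ofReal (Real.exp (-(c * u))) ∂expMeasure 1 ≠ ∞ := by
    refine ne_top_of_le_ne_top ?_ (lintegral_mono_ae (hlt.mono fun u h => h.le))
    simp
  calc _ < ∫⁻ _, (1 : ℝ≥0∞) ∂expMeasure 1 :=
        lintegral_strict_mono (IsProbabilityMeasure.ne_zero _) aemeasurable_const h2 hlt
    _ = 1 := h1

/-- Both almost sure limits below rest on this: an expectation bounded by `c < 1` times itself
vanishes. Finiteness excludes `∞ ≤ c * ∞`. -/
lemma eq_zero_of_le_mul {c x : ℝ≥0∞} (hc : c < 1) (hx : x ≠ ∞) (h : x ≤ c * x) : x = 0 := by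
  by_contra h0
  have := ENNReal.mul_lt_mul_left h0 hx hc
  simp only [one_mul] at this
  exact absurd h (not_le.2 (by simpa [mul_comm] using this))

lemma ae_clock_pos : ∀ᵐ ω ∂clockLaw, ∀ k, 0 < ω k := by
  rw [ae_all_iff]
  intro k
  exact (measurePreserving_eval_infinitePi (fun _ : ℕ => expMeasure 1) k
    ).quasiMeasurePreserving.ae ae_expMeasure_pos

/-- Let `F` be `e` to the minus total clock sum, as an infimum over partial sums. Then `F ω ≤ e^{-ω
0} F (shift ω)` with independent factors, so `E F ≤ E e^{-ω 0} * E F`. The first factor is below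
`1`, hence `F = 0` almost surely. -/
lemma ae_regular : ∀ᵐ ω ∂clockLaw, Regular ω := by
  set F : (ℕ → ℝ) → ℝ≥0∞ :=
    fun ω => ⨅ n : ℕ, ENNReal.ofReal (Real.exp (-∑ k ∈ Finset.range n, ω k)) with hF
  have hFm : Measurable F := Measurable.iInf fun n => by fun_prop
  have hle1 : ∀ ω, F ω ≤ 1 := fun ω => (iInf_le _ 0).trans (by simp)
  have hstep : ∀ ω, F ω ≤ ENNReal.ofReal (Real.exp (-(1 * ω 0))) * F (shift ω) := by
    intro ω
    simp only [hF]
    rw [ENNReal.mul_iInf_of_ne (by simp [Real.exp_pos]) ENNReal.ofReal_ne_top]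
    refine le_iInf fun n => (iInf_le _ (n + 1)).trans (le_of_eq ?_)
    rw [← ENNReal.ofReal_mul (Real.exp_nonneg _), ← Real.exp_add, Finset.sum_range_succ']
    congr 2
    simp only [shift]
    ring
  have hint : ∫⁻ ω, F ω ∂clockLaw ≤
      (∫⁻ u, ENNReal.ofReal (Real.exp (-(1 * u))) ∂expMeasure 1) * ∫⁻ ω, F ω ∂clockLaw := by
    refine (lintegral_mono hstep).trans (le_of_eq ?_)
    rw [lintegral_clockLaw (G := fun p => ENNReal.ofReal (Real.exp (-(1 * p.1))) * F p.2)
      (by fun_prop), ← lintegral_mul_const _ (by fun_prop)]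
    refine lintegral_congr fun u => ?_
    dsimp only
    rw [lintegral_const_mul _ hFm]
  have hfin : ∫⁻ ω, F ω ∂clockLaw ≠ ∞ :=
    ne_top_of_le_ne_top (by simp) (lintegral_mono hle1)
  have h0 := (lintegral_eq_zero_iff hFm).1
    (eq_zero_of_le_mul (lintegral_exp_neg_lt_one one_pos) hfin hint)
  filter_upwards [h0, ae_clock_pos] with ω hω hpos
  refine ⟨hpos, ?_⟩
  refine tendsto_atTop_atTop_of_monotone (monotone_nat_of_le_succ fun n => ?_) fun b => ?_
  · rw [Finset.sum_range_succ]
    linarith [hpos n]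
  · have : F ω < ENNReal.ofReal (Real.exp (-b)) := by
      rw [hω]; simp [Real.exp_pos]
    obtain ⟨n, hn⟩ := iInf_lt_iff.1 this
    refine ⟨n, ?_⟩
    rw [ENNReal.ofReal_lt_ofReal_iff (Real.exp_pos _), Real.exp_lt_exp] at hn
    linarith

/-- The same contraction over a cycle of two switches. A stay in state `1` contributes a factor at
most `1`, a stay in state `0` a factor of mean below `1` because `γ 0 > 0`. -/
lemma tendsto_exp_neg_cumRate (hlam : ∀ i, 0 < lam i) (hγ0 : 0 < γ 0) (hγ : ∀ i, 0 ≤ γ i)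
    (i : Fin 2) :
    ∀ᵐ ω ∂clockLaw, Tendsto (fun n : ℕ => Real.exp (-cumRate lam γ i ω n)) atTop (𝓝 0) := by
  set Z : Fin 2 → (ℕ → ℝ) → ℝ≥0∞ :=
    fun i ω => ⨅ n : ℕ, ENNReal.ofReal (Real.exp (-cumRate lam γ i ω n)) with hZ
  have hZm : ∀ i, Measurable (Z i) := fun i => Measurable.iInf fun n =>
    ((measurable_cumRate lam γ i).comp (f := fun ω : ℕ → ℝ => (ω, (n : ℝ)))
      measurable_prodMk_right).neg.exp.ennreal_ofReal
  have hle1 : ∀ i ω, Z i ω ≤ 1 := fun i ω => (iInf_le _ 0).trans (by simp [cumRate])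
  have hstep : ∀ i, ∀ ω, Regular ω → Z i ω ≤
      ENNReal.ofReal (Real.exp (-(γ i / lam i * ω 0))) * Z (i + 1) (shift ω) := by
    intro i ω hω
    simp only [hZ]
    rw [ENNReal.mul_iInf_of_ne (by simp [Real.exp_pos]) ENNReal.ofReal_ne_top]
    refine le_iInf fun m => ?_
    -- Integer times are not aligned with the switch; any integer beyond `m` plus the holding time
    -- will do, as `Γ` is monotone.
    obtain ⟨n, hn⟩ := exists_nat_ge (m + ω 0 / lam i)
    refine (iInf_le _ n).trans ?_
    have hm : (0 : ℝ) ≤ m := m.cast_nonneg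
    rw [← ENNReal.ofReal_mul (Real.exp_nonneg _), ← Real.exp_add,
      cumRate_of_ge hlam hω γ (i := i) (t := n) (by linarith)]
    refine ENNReal.ofReal_le_ofReal (Real.exp_le_exp.2 ?_)
    have := cumRate_mono (lam := lam) hγ (i + 1) (shift ω)
      (show (m : ℝ) ≤ n - ω 0 / lam i by linarith)
    have h2 : γ i / lam i * ω 0 = γ i * (ω 0 / lam i) := by ring
    linarith
  have hint : ∀ i, ∫⁻ ω, Z i ω ∂clockLaw ≤
      (∫⁻ u, ENNReal.ofReal (Real.exp (-(γ i / lam i * u))) ∂expMeasure 1) *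
        ∫⁻ ω, Z (i + 1) ω ∂clockLaw := by
    intro i
    refine (lintegral_mono_ae (ae_regular.mono (hstep i))).trans (le_of_eq ?_)
    have := hZm (i + 1)
    rw [lintegral_clockLaw
      (G := fun p => ENNReal.ofReal (Real.exp (-(γ i / lam i * p.1))) * Z (i + 1) p.2)
      (by fun_prop), ← lintegral_mul_const _ (by fun_prop)]
    refine lintegral_congr fun u => ?_
    dsimp only
    rw [lintegral_const_mul _ this]
  have hfin : ∀ i, ∫⁻ ω, Z i ω ∂clockLaw ≠ ∞ := fun i =>
    ne_top_of_le_ne_top (by simp) (lintegral_mono (hle1 i))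
  have h10 : ∫⁻ ω, Z 1 ω ∂clockLaw ≤ ∫⁻ ω, Z 0 ω ∂clockLaw := by
    refine (hint 1).trans ?_
    have hf : ∫⁻ u, ENNReal.ofReal (Real.exp (-(γ 1 / lam 1 * u))) ∂expMeasure 1 ≤ 1 := by
      refine (lintegral_mono_ae (g := fun _ => 1) ?_).trans (by simp)
      filter_upwards [ae_expMeasure_pos] with u hu
      rw [← ENNReal.ofReal_one]
      refine ENNReal.ofReal_le_ofReal (Real.exp_le_one_iff.2 ?_)
      have := mul_nonneg (div_nonneg (hγ 1) (hlam 1).le) hu.le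
      linarith
    exact (mul_le_mul_left hf _).trans (by simp)
  have h0 : ∫⁻ ω, Z 0 ω ∂clockLaw = 0 := by
    refine eq_zero_of_le_mul (lintegral_exp_neg_lt_one (div_pos hγ0 (hlam 0))) (hfin 0) ?_
    exact (hint 0).trans (mul_le_mul_right h10 _)
  have hi : ∫⁻ ω, Z i ω ∂clockLaw = 0 := by
    fin_cases i
    · exact h0
    · exact le_antisymm (h10.trans h0.le) bot_le
  filter_upwards [(lintegral_eq_zero_iff (hZm i)).1 hi] with ω hω
  have hanti : Antitone fun n : ℕ => ENNReal.ofReal (Real.exp (-cumRate lam γ i ω n)) :=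
    fun m n hmn => ENNReal.ofReal_le_ofReal (Real.exp_le_exp.2
      (neg_le_neg (cumRate_mono hγ i ω (Nat.cast_le.2 hmn))))
  have hlim := tendsto_atTop_iInf hanti
  rw [show (⨅ n : ℕ, ENNReal.ofReal (Real.exp (-cumRate lam γ i ω n))) = 0 from hω] at hlim
  have h := (ENNReal.tendsto_toReal ENNReal.zero_ne_top).comp hlim
  simpa [Function.comp_def, ENNReal.toReal_ofReal (Real.exp_nonneg _)] using h

end

section

variable {lam a γ : Fin 2 → ℝ}

/-! ### Uniqueness of the invariant probability measure -/

lemma expMeasure_ne_zero {S : Set ℝ} (hS : volume (S ∩ Ioi 0) ≠ 0) : expMeasure 1 S ≠ 0 := by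
  have h1 : expMeasure 1 = volume.withDensity (gammaPDF 1 1) := rfl
  have h2 : Measurable (gammaPDF 1 1) := (measurable_gammaPDFReal 1 1).ennreal_ofReal
  rw [h1, Ne, withDensity_apply_eq_zero h2]
  intro h
  refine hS (measure_mono_null ?_ h)
  rintro u ⟨hu, hu0⟩
  have := gammaPDFReal_pos (x := u) one_pos one_pos hu0
  refine ⟨?_, hu⟩
  simpa [gammaPDF] using this

lemma clockLaw_chain_one_pos (hlam : ∀ i, 0 < lam i) :
    clockLaw {ω | chain lam 1 ω 1 = 0} ≠ 0 := by
  classical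
  -- On this box of two clocks the first switch occurs by time `1` and the following stay in state
  -- `0` lasts longer than `1`.
  set t : ℕ → Set ℝ := fun k => if k = 0 then Iic (lam 1) else Ioi (lam 0) with ht
  have htm : ∀ k, MeasurableSet (t k) := by
    intro k
    simp only [ht]
    split_ifs
    exacts [measurableSet_Iic, measurableSet_Ioi]
  have hbox : clockLaw (Set.pi (Finset.range 2 : Set ℕ) t) ≠ 0 := by
    rw [clockLaw, Measure.infinitePi_pi _ fun k _ => htm k]
    refine Finset.prod_ne_zero_iff.2 fun k _ => expMeasure_ne_zero ?_
    simp only [ht]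
    split_ifs
    · rw [inter_comm, Ioi_inter_Iic]
      simpa using hlam 1
    · rw [Ioi_inter_Ioi]
      simp
  intro h0
  refine hbox (measure_mono_null_ae ?_ h0)
  filter_upwards [ae_regular] with ω hω hmem
  have hmem' : ω ∈ Set.pi (Finset.range 2 : Set ℕ) t := hmem
  have h0 : ω 0 ≤ lam 1 := by simpa [ht] using hmem' 0 (by simp)
  have h1 : lam 0 < ω 1 := by simpa [ht] using hmem' 1 (by simp)
  have hτ : ω 0 / lam 1 ≤ 1 := (div_le_one (hlam 1)).2 h0
  have hτ0 : 0 < ω 0 / lam 1 := div_pos (hω.pos 0) (hlam 1)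
  have h2 : 1 < ω 1 / lam 0 := (one_lt_div (hlam 0)).2 h1
  show chain lam 1 ω 1 = 0
  rw [chain_of_ge hlam hω hτ]
  refine chain_of_lt hlam hω.shift ?_
  show 1 - ω 0 / lam 1 < ω 1 / lam 0
  linarith

/-- The law of the chain under an invariant probability measure. -/
lemma invariant_marginal (hlam : ∀ i, 0 < lam i) {μ : Measure (ℝ × Fin 2)}
    [IsProbabilityMeasure μ] (hμ : IsInvariant lam a γ μ) :
    (μ.map Prod.snd).real {0} =
      clockLaw.real {ω | chain lam 1 ω 1 = 0} /
        (1 - clockLaw.real {ω | chain lam 0 ω 1 = 0} + clockLaw.real {ω | chain lam 1 ω 1 = 0}) := by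
  set p : Fin 2 → ℝ := fun i => clockLaw.real {ω | chain lam i ω 1 = 0} with hp
  have : IsProbabilityMeasure (μ.map Prod.snd) :=
    Measure.isProbabilityMeasure_map measurable_snd.aemeasurable
  have h1 := hμ 1 zero_le_one (Prod.snd ⁻¹' {0}) (measurable_snd (measurableSet_singleton 0))
  have h2 : ∀ z, transition lam a γ 1 z (Prod.snd ⁻¹' {0}) = ENNReal.ofReal (p z.2) := by
    intro z
    rw [hp]
    simp only [measureReal_def]
    rw [ENNReal.ofReal_toReal (measure_ne_top _ _)]
    rfl
  simp only [h2] at h1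
  rw [← lintegral_map (f := fun i => ENNReal.ofReal (p i)) (measurable_of_finite _) measurable_snd,
    ← Measure.map_apply measurable_snd (measurableSet_singleton 0), lintegral_fintype,
    Fin.sum_univ_two] at h1
  have h3 := congrArg ENNReal.toReal h1
  rw [ENNReal.toReal_add (ENNReal.mul_ne_top ENNReal.ofReal_ne_top (measure_ne_top _ _))
    (ENNReal.mul_ne_top ENNReal.ofReal_ne_top (measure_ne_top _ _)), ENNReal.toReal_mul,
    ENNReal.toReal_mul, ENNReal.toReal_ofReal measureReal_nonneg,
    ENNReal.toReal_ofReal measureReal_nonneg] at h3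
  have h4 : (μ.map Prod.snd).real {0} + (μ.map Prod.snd).real {1} = 1 := by
    have := sum_measureReal_singleton (μ := μ.map Prod.snd) (Finset.univ : Finset (Fin 2))
    rw [Fin.sum_univ_two] at this
    simpa using this
  -- A positive probability of going from `1` to `0` in unit time makes the denominator positive, so
  -- the balance equation has one solution.
  have h5 : 0 < p 1 := by
    refine lt_of_le_of_ne measureReal_nonneg (Ne.symm ?_)
    simp only [hp, measureReal_def]
    exact (ENNReal.toReal_pos (clockLaw_chain_one_pos hlam) (measure_ne_top _ _)).ne'
  have h6 : p 0 ≤ 1 := measureReal_le_one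
  change p 0 * (μ.map Prod.snd).real {0} + p 1 * (μ.map Prod.snd).real {1} =
    (μ.map Prod.snd).real {0} at h3
  change _ = p 1 / (1 - p 0 + p 1)
  rw [eq_div_iff (by linarith)]
  linear_combination p 1 * h4 - h3

lemma invariant_marginal_unique (hlam : ∀ i, 0 < lam i) {μ ν : Measure (ℝ × Fin 2)}
    [IsProbabilityMeasure μ] [IsProbabilityMeasure ν] (hμ : IsInvariant lam a γ μ)
    (hν : IsInvariant lam a γ ν) : μ.map Prod.snd = ν.map Prod.snd := by
  have hμp : IsProbabilityMeasure (μ.map Prod.snd) :=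
    Measure.isProbabilityMeasure_map measurable_snd.aemeasurable
  have hνp : IsProbabilityMeasure (ν.map Prod.snd) :=
    Measure.isProbabilityMeasure_map measurable_snd.aemeasurable
  have h0 : (μ.map Prod.snd).real {0} = (ν.map Prod.snd).real {0} := by
    rw [invariant_marginal hlam hμ, invariant_marginal hlam hν]
  have hsum : ∀ m : Measure (Fin 2), IsProbabilityMeasure m → m.real {0} + m.real {1} = 1 := by
    intro m _
    have := sum_measureReal_singleton (μ := m) (Finset.univ : Finset (Fin 2))
    rw [Fin.sum_univ_two] at this
    simpa using this
  refine Measure.ext_of_singleton fun i => ?_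
  rw [← measureReal_eq_measureReal_iff]
  fin_cases i
  · exact h0
  · have h1 := hsum _ hμp
    have h2 := hsum _ hνp
    show (μ.map Prod.snd).real {1} = (ν.map Prod.snd).real {1}
    linarith

/-! ### Coupling and characteristic functions -/

lemma ae_tendsto_exp_neg_cumRate (hlam : ∀ i, 0 < lam i) (hγ0 : 0 < γ 0) (hγ : ∀ i, 0 ≤ γ i)
    (μ : Measure (ℝ × Fin 2)) [SFinite μ] :
    ∀ᵐ p ∂μ.prod clockLaw, Regular p.2 ∧
      ∀ i, Tendsto (fun n : ℕ => Real.exp (-cumRate lam γ i p.2 n)) atTop (𝓝 0) :=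
  Measure.quasiMeasurePreserving_snd.ae (ae_regular.and
    (ae_all_iff.2 fun i => tendsto_exp_neg_cumRate hlam hγ0 hγ i))

/-- The additive character `x ↦ e^{iθx}` on `ℝ × {j}`, extended by zero. -/
noncomputable def charAt (θ : ℝ) (j : Fin 2) (z : ℝ × Fin 2) : ℂ :=
  if z.2 = j then Complex.exp (θ * z.1 * Complex.I) else 0

lemma measurable_charAt (θ : ℝ) (j : Fin 2) : Measurable (charAt θ j) := by
  unfold charAt
  refine Measurable.ite (measurable_snd (measurableSet_singleton j)) ?_ measurable_const
  fun_prop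

lemma norm_charAt_le (θ : ℝ) (j : Fin 2) (z : ℝ × Fin 2) : ‖charAt θ j z‖ ≤ 1 := by
  unfold charAt
  split_ifs
  · rw [← Complex.ofReal_mul, Complex.norm_exp_ofReal_mul_I]
  · simp

/-- The bound involves only the difference of the positions, which is what the coupling controls. -/
lemma norm_charAt_sub_le (θ : ℝ) (j : Fin 2) (x y : ℝ) (i : Fin 2) :
    ‖charAt θ j (x, i) - charAt θ j (y, i)‖ ≤
      ‖Complex.exp (((θ * (x - y) : ℝ) : ℂ) * Complex.I) - 1‖ := by
  unfold charAt
  dsimp only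
  split_ifs
  · have : Complex.exp (θ * x * Complex.I) - Complex.exp (θ * y * Complex.I) =
        Complex.exp (((θ * y : ℝ) : ℂ) * Complex.I) *
          (Complex.exp (((θ * (x - y) : ℝ) : ℂ) * Complex.I) - 1) := by
      rw [mul_sub, ← Complex.exp_add]
      push_cast
      ring_nf
    rw [this, norm_mul, Complex.norm_exp_ofReal_mul_I, one_mul]
  · simp

lemma integrable_of_norm_le_one {α : Type*} [MeasurableSpace α] {μ : Measure α}
    [IsFiniteMeasure μ] {f : α → ℂ} (hf : Measurable f) (h : ∀ x, ‖f x‖ ≤ 1) : Integrable f μ :=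
  Integrable.of_bound hf.aestronglyMeasurable 1 (Eventually.of_forall h)

/-- The process forgets its starting point. -/
lemma tendsto_integral_charAt (hlam : ∀ i, 0 < lam i) (hγ0 : 0 < γ 0) (hγ : ∀ i, 0 ≤ γ i)
    {μ : Measure (ℝ × Fin 2)} [IsProbabilityMeasure μ] (hμ : IsInvariant lam a γ μ) (θ : ℝ)
    (j : Fin 2) :
    Tendsto (fun n : ℕ => ∫ i, ∫ ω, charAt θ j (stateAt lam a γ n ((0, i), ω)) ∂clockLaw
      ∂μ.map Prod.snd) atTop (𝓝 (∫ z, charAt θ j z ∂μ)) := by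
  have hmap : ∀ n : ℕ, ∫ z, charAt θ j z ∂μ =
      ∫ p, charAt θ j (stateAt lam a γ n p) ∂μ.prod clockLaw := by
    intro n
    conv_lhs => rw [← isInvariant_iff.1 hμ n n.cast_nonneg]
    exact integral_map (measurable_stateAt lam a γ n).aemeasurable
      (measurable_charAt θ j).aestronglyMeasurable
  have hm1 : ∀ n : ℕ, Measurable fun p => charAt θ j (stateAt lam a γ n p) := fun n =>
    (measurable_charAt θ j).comp (measurable_stateAt lam a γ n)
  have hm2 : ∀ n : ℕ, Measurable fun p : (ℝ × Fin 2) × (ℕ → ℝ) =>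
      charAt θ j (stateAt lam a γ n ((0, p.1.2), p.2)) := fun n =>
    (hm1 n).comp (f := fun p : (ℝ × Fin 2) × (ℕ → ℝ) => ((0, p.1.2), p.2)) (by fun_prop)
  have hsnd : ∀ n : ℕ, ∫ i, ∫ ω, charAt θ j (stateAt lam a γ n ((0, i), ω)) ∂clockLaw
      ∂μ.map Prod.snd =
      ∫ p, charAt θ j (stateAt lam a γ n ((0, p.1.2), p.2)) ∂μ.prod clockLaw := by
    intro n
    rw [integral_map measurable_snd.aemeasurable
      (measurable_of_finite _).aestronglyMeasurable, integral_prod]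
    exact integrable_of_norm_le_one (hm2 n) fun _ => norm_charAt_le _ _ _
  -- Processes started at `0` and at `X(0)` with the same clocks are at distance `|X(0)| e^{-Γ(n)}`;
  -- bounded convergence does the rest.
  have hlim : Tendsto (fun n : ℕ => ∫ p, (charAt θ j (stateAt lam a γ n ((0, p.1.2), p.2)) -
      charAt θ j (stateAt lam a γ n p)) ∂μ.prod clockLaw) atTop (𝓝 0) := by
    rw [← integral_zero ((ℝ × Fin 2) × (ℕ → ℝ)) ℂ (μ := μ.prod clockLaw)]
    refine tendsto_integral_of_dominated_convergence (fun _ => 2)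
      (fun n => ((hm2 n).sub (hm1 n)).aestronglyMeasurable) (integrable_const _)
      (fun n => Eventually.of_forall fun p => ?_) ?_
    · refine (norm_sub_le _ _).trans ?_
      linarith [norm_charAt_le θ j (stateAt lam a γ n ((0, p.1.2), p.2)),
        norm_charAt_le θ j (stateAt lam a γ n p)]
    · filter_upwards [ae_tendsto_exp_neg_cumRate hlam hγ0 hγ μ] with p hp
      refine squeeze_zero_norm (fun n => norm_charAt_sub_le θ j _ _ _) ?_
      have h1 : Tendsto (fun n : ℕ => θ * (process lam a γ 0 p.1.2 p.2 n -
          process lam a γ p.1.1 p.1.2 p.2 n)) atTop (𝓝 0) := by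
        have h2 : ∀ n : ℕ, θ * (process lam a γ 0 p.1.2 p.2 n -
            process lam a γ p.1.1 p.1.2 p.2 n) =
            θ * (0 - p.1.1) * Real.exp (-cumRate lam γ p.1.2 p.2 n) := by
          intro n
          rw [process_eq_add lam a γ 0 p.1.1]
          ring
        simp only [h2]
        simpa using (hp.2 p.1.2).const_mul (θ * (0 - p.1.1))
      have hc : Continuous fun r : ℝ => ‖Complex.exp ((r : ℂ) * Complex.I) - 1‖ := by fun_prop
      simpa [Function.comp_def] using (hc.tendsto 0).comp h1
  have h2 := (tendsto_const_nhds (x := ∫ z, charAt θ j z ∂μ)).add hlim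
  rw [add_zero] at h2
  refine h2.congr fun n => ?_
  rw [integral_sub (integrable_of_norm_le_one (hm2 n) fun _ => norm_charAt_le _ _ _)
    (integrable_of_norm_le_one (hm1 n) fun _ => norm_charAt_le _ _ _), hsnd n, hmap n]
  ring

/-- Integrals of `charAt θ j` form the characteristic function of the slice over `j`, and the slices
determine the measure. -/
lemma ext_of_integral_charAt {μ ν : Measure (ℝ × Fin 2)} [IsFiniteMeasure μ] [IsFiniteMeasure ν]
    (h : ∀ θ j, ∫ z, charAt θ j z ∂μ = ∫ z, charAt θ j z ∂ν) : μ = ν := by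
  have hms : ∀ j : Fin 2, MeasurableSet (Prod.snd ⁻¹' {j} : Set (ℝ × Fin 2)) := fun j =>
    measurable_snd (measurableSet_singleton j)
  have hchar : ∀ (κ : Measure (ℝ × Fin 2)) (θ : ℝ) (j : Fin 2),
      charFun ((κ.restrict (Prod.snd ⁻¹' {j})).map Prod.fst) θ = ∫ z, charAt θ j z ∂κ := by
    intro κ θ j
    rw [charFun_apply_real, integral_map measurable_fst.aemeasurable
      (by fun_prop), ← integral_indicator (hms j)]
    refine integral_congr_ae (Eventually.of_forall fun z => ?_)
    by_cases hz : z.2 = j <;> simp [charAt, hz]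
  have hj : ∀ j : Fin 2, (μ.restrict (Prod.snd ⁻¹' {j})).map Prod.fst =
      (ν.restrict (Prod.snd ⁻¹' {j})).map Prod.fst := fun j =>
    Measure.ext_of_charFun (by ext θ; rw [hchar, hchar, h])
  have hsplit : ∀ (κ : Measure (ℝ × Fin 2)) (B : Set (ℝ × Fin 2)), MeasurableSet B →
      κ B = ∑ j, (κ.restrict (Prod.snd ⁻¹' {j})).map Prod.fst {x : ℝ | (x, j) ∈ B} := by
    intro κ B hB
    have h1 : ∀ j, (κ.restrict (Prod.snd ⁻¹' {j})).map Prod.fst {x : ℝ | (x, j) ∈ B} =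
        κ (B ∩ Prod.snd ⁻¹' {j}) := by
      intro j
      have hBj : MeasurableSet {x : ℝ | (x, j) ∈ B} := measurable_prodMk_right hB
      rw [Measure.map_apply measurable_fst hBj, Measure.restrict_apply (measurable_fst hBj)]
      congr 1
      ext z
      constructor
      · rintro ⟨h1, h2⟩
        have h2' : z.2 = j := h2
        have h1' : (z.1, j) ∈ B := h1
        exact ⟨by rwa [← h2'] at h1', h2⟩
      · rintro ⟨h1, h2⟩
        have h2' : z.2 = j := h2
        refine ⟨?_, h2⟩
        show (z.1, j) ∈ B
        rwa [← h2']
    simp only [h1]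
    rw [Fin.sum_univ_two, ← measure_inter_add_sdiff B (hms 0)]
    congr 2
    ext z
    have : z.2 = 1 ↔ ¬ z.2 = 0 := by omega
    simp [this]
  ext B hB
  rw [hsplit μ B hB, hsplit ν B hB]
  simp only [hj]

/-- Once the marginals on `Fin 2` agree, both integrals are limits of one and the same sequence. -/
theorem invariant_unique (hlam : ∀ i, 0 < lam i) (hγ0 : 0 < γ 0) (hγ : ∀ i, 0 ≤ γ i)
    {μ ν : Measure (ℝ × Fin 2)} [IsProbabilityMeasure μ] [IsProbabilityMeasure ν]
    (hμ : IsInvariant lam a γ μ) (hν : IsInvariant lam a γ ν) : μ = ν := by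
  refine ext_of_integral_charAt fun θ j => ?_
  have h1 := tendsto_integral_charAt hlam hγ0 hγ hμ θ j
  rw [invariant_marginal_unique hlam hμ hν] at h1
  exact tendsto_nhds_unique h1 (tendsto_integral_charAt hlam hγ0 hγ hν θ j)

/-- If both velocity fields vanish at `ρ`, invariant probability measures live on `{ρ} × {0, 1}`. -/
theorem invariant_concentrated (hlam : ∀ i, 0 < lam i) (hγ0 : 0 < γ 0) (hγ : ∀ i, 0 ≤ γ i)
    {ρ : ℝ} (ha : ∀ i, a i = γ i * ρ) {μ : Measure (ℝ × Fin 2)} [IsProbabilityMeasure μ]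
    (hμ : IsInvariant lam a γ μ) : μ {z | z.1 ≠ ρ} = 0 := by
  -- The truncation makes the distance to `ρ` integrable without any moment assumption on `μ`.
  set f : ℝ × Fin 2 → ℝ := fun z => min |z.1 - ρ| 1 with hf
  have hfm : Measurable f := by fun_prop
  have hf0 : ∀ z, 0 ≤ f z := fun z => le_min (abs_nonneg _) zero_le_one
  have hf1 : ∀ z, f z ≤ 1 := fun z => min_le_right _ _
  have hmap : ∀ n : ℕ, ∫ z, f z ∂μ = ∫ p, f (stateAt lam a γ n p) ∂μ.prod clockLaw := by
    intro n
    conv_lhs => rw [← isInvariant_iff.1 hμ n n.cast_nonneg]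
    exact integral_map (measurable_stateAt lam a γ n).aemeasurable hfm.aestronglyMeasurable
  have hlim : Tendsto (fun n : ℕ => ∫ p, f (stateAt lam a γ n p) ∂μ.prod clockLaw) atTop
      (𝓝 0) := by
    rw [← integral_zero ((ℝ × Fin 2) × (ℕ → ℝ)) ℝ (μ := μ.prod clockLaw)]
    refine tendsto_integral_of_dominated_convergence (fun _ => 1)
      (fun n => (hfm.comp (measurable_stateAt lam a γ n)).aestronglyMeasurable)
      (integrable_const _) (fun n => Eventually.of_forall fun p => ?_) ?_
    · rw [Real.norm_of_nonneg (hf0 _)]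
      exact hf1 _
    · filter_upwards [ae_tendsto_exp_neg_cumRate hlam hγ0 hγ μ] with p hp
      have h2 := ((hp.2 p.1.2).const_mul (p.1.1 - ρ)).abs
      rw [mul_zero, abs_zero] at h2
      refine squeeze_zero (fun n => hf0 _) (fun n => (min_le_left _ _).trans (le_of_eq ?_)) h2
      simp only [stateAt]
      rw [process_eq_add lam a γ p.1.1 ρ, process_rest hlam hp.1 ha, add_sub_cancel_left]
  have h0 : ∫ z, f z ∂μ = 0 :=
    tendsto_nhds_unique (tendsto_const_nhds.congr hmap) hlim
  have hint : Integrable f μ := Integrable.of_bound hfm.aestronglyMeasurable 1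
    (Eventually.of_forall fun z => by rw [Real.norm_of_nonneg (hf0 z)]; exact hf1 z)
  have h3 := (integral_eq_zero_iff_of_nonneg hf0 hint).1 h0
  have h4 : ∀ᵐ z ∂μ, z.1 = ρ := by
    filter_upwards [h3] with z hz
    have hz' : min |z.1 - ρ| 1 = 0 := hz
    rcases min_choice |z.1 - ρ| 1 with h | h
    · rw [h] at hz'
      linarith [abs_eq_zero.1 hz']
    · rw [h] at hz'
      exact absurd hz' one_ne_zero
  simpa [ae_iff] using h4

/-! ### Measures given by densities -/

lemma densityMeasure_eq (π : Fin 2 → ℝ → ℝ) : densityMeasure π =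
    (volume.withDensity fun x => ENNReal.ofReal (π 0 x)).map (fun x => (x, (0 : Fin 2))) +
      (volume.withDensity fun x => ENNReal.ofReal (π 1 x)).map (fun x => (x, (1 : Fin 2))) := by
  rw [densityMeasure, Measure.sum_fintype, Fin.sum_univ_two]

lemma lintegral_densityMeasure {π : Fin 2 → ℝ → ℝ} (hπ : ∀ i, AEMeasurable (π i))
    {f : ℝ × Fin 2 → ℝ≥0∞} (hf : Measurable f) :
    ∫⁻ z, f z ∂densityMeasure π = ∑ i, ∫⁻ x, ENNReal.ofReal (π i x) * f (x, i) := by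
  have h : ∀ i : Fin 2, ∫⁻ z, f z ∂((volume.withDensity fun x => ENNReal.ofReal (π i x)).map
      (fun x => (x, i))) = ∫⁻ x, ENNReal.ofReal (π i x) * f (x, i) := by
    intro i
    have hfi : Measurable fun x => f (x, i) := hf.comp measurable_prodMk_right
    rw [lintegral_map hf measurable_prodMk_right,
      lintegral_withDensity_eq_lintegral_mul₀ (hπ i).ennreal_ofReal hfi.aemeasurable]
    rfl
  rw [densityMeasure_eq, lintegral_add_measure, h, h, Fin.sum_univ_two]

lemma isProbabilityMeasure_densityMeasure {π : Fin 2 → ℝ → ℝ} (h0 : ∀ i x, 0 ≤ π i x)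
    (hi : ∀ i, Integrable (π i)) (h1 : ∫ x, (π 0 x + π 1 x) = 1) :
    IsProbabilityMeasure (densityMeasure π) := by
  constructor
  rw [← lintegral_one, lintegral_densityMeasure (fun i => (hi i).aemeasurable) measurable_const,
    Fin.sum_univ_two]
  simp only [mul_one]
  rw [← ofReal_integral_eq_lintegral_ofReal (hi 0) (Eventually.of_forall (h0 0)),
    ← ofReal_integral_eq_lintegral_ofReal (hi 1) (Eventually.of_forall (h0 1)),
    ← ENNReal.ofReal_add (integral_nonneg (h0 0)) (integral_nonneg (h0 1)),
    ← integral_add (hi 0) (hi 1), h1, ENNReal.ofReal_one]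

lemma IsInvariantDensity.isProbabilityMeasure {π : Fin 2 → ℝ → ℝ}
    (h : IsInvariantDensity lam a γ π) : IsProbabilityMeasure (densityMeasure π) :=
  isProbabilityMeasure_densityMeasure h.nonneg h.integrable h.integral_eq_one

lemma ae_eq_of_densityMeasure_eq {π π' : Fin 2 → ℝ → ℝ} (h0 : ∀ i x, 0 ≤ π i x)
    (hi : ∀ i, Integrable (π i)) (h0' : ∀ i x, 0 ≤ π' i x) (hi' : ∀ i, Integrable (π' i))
    (h : densityMeasure π = densityMeasure π') (i : Fin 2) : π i =ᵐ[volume] π' i := by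
  have key : ∀ {π : Fin 2 → ℝ → ℝ}, (∀ i, Integrable (π i)) → ∀ B : Set ℝ, MeasurableSet B →
      densityMeasure π (B ×ˢ {i}) = ∫⁻ x in B, ENNReal.ofReal (π i x) := by
    intro π hπ B hB
    have hBi : MeasurableSet (B ×ˢ {i} : Set (ℝ × Fin 2)) := hB.prod (measurableSet_singleton i)
    rw [← lintegral_indicator_one hBi, lintegral_densityMeasure (fun i => (hπ i).aemeasurable)
      (measurable_one.indicator hBi), Finset.sum_eq_single i, ← lintegral_indicator hB]
    · refine lintegral_congr fun x => ?_
      by_cases hx : x ∈ B <;> simp [indicator, hx]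
    · intro j _ hj
      simp [indicator, hj]
    · simp
  have h1 : volume.withDensity (fun x => ENNReal.ofReal (π i x)) =
      volume.withDensity (fun x => ENNReal.ofReal (π' i x)) := by
    ext B hB
    rw [withDensity_apply _ hB, withDensity_apply _ hB, ← key hi B hB, ← key hi' B hB, h]
  have h2 := (withDensity_eq_iff (hi i).aemeasurable.ennreal_ofReal
    (hi' i).aemeasurable.ennreal_ofReal (hi i).lintegral_lt_top.ne).1 h1
  filter_upwards [h2] with x hx
  exact (ENNReal.ofReal_eq_ofReal_iff (h0 i x) (h0' i x)).1 hx

/-- Invariance puts all mass over `ρ`, while a density gives that null set no mass. -/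
theorem not_exists_isInvariantDensity (hlam : ∀ i, 0 < lam i) (hγ0 : 0 < γ 0)
    (hγ : ∀ i, 0 ≤ γ i) {ρ : ℝ} (ha : ∀ i, a i = γ i * ρ) :
    ¬ ∃ π : Fin 2 → ℝ → ℝ, IsInvariantDensity lam a γ π := by
  rintro ⟨π, hπ⟩
  have := hπ.isProbabilityMeasure
  have h1 := invariant_concentrated hlam hγ0 hγ ha hπ.invariant
  have hm : MeasurableSet {z : ℝ × Fin 2 | z.1 = ρ} := measurable_fst (measurableSet_singleton ρ)
  have h2 : densityMeasure π {z | z.1 = ρ} = 0 := by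
    rw [← lintegral_indicator_one hm, lintegral_densityMeasure
      (fun i => (hπ.integrable i).aemeasurable) (measurable_one.indicator hm)]
    refine Finset.sum_eq_zero fun i _ => ?_
    rw [lintegral_eq_zero_of_ae_eq_zero]
    have h0 : ∀ᵐ x : ℝ, x ≠ ρ := by simp [ae_iff]
    filter_upwards [h0] with x hx
    simp [indicator, hx]
  have h3 : densityMeasure π univ = 0 := by
    refine measure_mono_null (fun z _ => ?_) (measure_union_null h1 h2)
    exact (ne_or_eq z.1 ρ)
  simp at h3

end

section

/-! ### Uniqueness for the Laplace transform -/

/-- Weierstrass approximation on `[0, 1]`, where both measures are carried. -/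
lemma ext_of_moments {μ ν : Measure ℝ} [IsFiniteMeasure μ] [IsFiniteMeasure ν]
    (hμ : μ (Icc 0 1)ᶜ = 0) (hν : ν (Icc 0 1)ᶜ = 0)
    (h : ∀ n : ℕ, ∫ x, x ^ n ∂μ = ∫ x, x ^ n ∂ν) : μ = ν := by
  have hae : ∀ {κ : Measure ℝ}, κ (Icc 0 1)ᶜ = 0 → ∀ᵐ x ∂κ, x ∈ Icc (0 : ℝ) 1 := fun h => h
  have hpow : ∀ {κ : Measure ℝ} [IsFiniteMeasure κ], κ (Icc 0 1)ᶜ = 0 → ∀ n : ℕ,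
      Integrable (fun x => x ^ n) κ := by
    intro κ _ hκ n
    refine Integrable.of_bound (by fun_prop) 1 ?_
    filter_upwards [hae hκ] with x hx
    rw [norm_pow, Real.norm_of_nonneg hx.1]
    exact pow_le_one₀ hx.1 hx.2
  have hpolyint : ∀ {κ : Measure ℝ} [IsFiniteMeasure κ], κ (Icc 0 1)ᶜ = 0 →
      ∀ p : Polynomial ℝ, Integrable (fun x => p.eval x) κ := by
    intro κ _ hκ p
    simp only [Polynomial.eval_eq_sum_range]
    exact integrable_finsetSum _ fun n _ => (hpow hκ n).const_mul _
  have hpoly : ∀ p : Polynomial ℝ, ∫ x, p.eval x ∂μ = ∫ x, p.eval x ∂ν := by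
    intro p
    simp only [Polynomial.eval_eq_sum_range]
    rw [integral_finsetSum _ fun n _ => (hpow hμ n).const_mul _,
      integral_finsetSum _ fun n _ => (hpow hν n).const_mul _]
    simp only [integral_const_mul, h]
  refine ext_of_forall_integral_eq_of_IsFiniteMeasure fun f => ?_
  have hbound : ∀ ε > 0, |∫ x, f x ∂μ - ∫ x, f x ∂ν| ≤ ε * (μ.real univ + ν.real univ) := by
    intro ε hε
    obtain ⟨p, hp⟩ := exists_polynomial_near_of_continuousOn 0 1 f f.continuous.continuousOn ε hε
    have key : ∀ {κ : Measure ℝ} [IsFiniteMeasure κ], κ (Icc 0 1)ᶜ = 0 →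
        |∫ x, f x ∂κ - ∫ x, p.eval x ∂κ| ≤ ε * κ.real univ := by
      intro κ _ hκ
      rw [← integral_sub (f.integrable κ) (hpolyint hκ p), ← Real.norm_eq_abs]
      refine norm_integral_le_of_norm_le_const ?_
      filter_upwards [hae hκ] with x hx
      rw [Real.norm_eq_abs, abs_sub_comm]
      exact (hp x hx).le
    have h1 := abs_le.1 (key hμ)
    have h2 := abs_le.1 (key hν)
    rw [hpoly p] at h1
    rw [abs_le]
    constructor <;> linarith [h1.1, h1.2, h2.1, h2.2]
  have hM : 0 ≤ μ.real univ + ν.real univ := by positivity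
  have h0 : |∫ x, f x ∂μ - ∫ x, f x ∂ν| ≤ 0 := by
    refine le_of_forall_pos_le_add fun ε hε => ?_
    refine (hbound (ε / (μ.real univ + ν.real univ + 1)) (by positivity)).trans ?_
    rw [zero_add, div_mul_eq_mul_div, div_le_iff₀ (by positivity)]
    nlinarith
  exact sub_eq_zero.1 (abs_nonpos_iff.1 h0)

lemma lintegral_exp_neg_mul {q : ℝ} (hq : 0 < q) :
    ∫⁻ t in Ioi 0, ENNReal.ofReal (Real.exp (-(q * t))) = ENNReal.ofReal q⁻¹ := by
  have h1 := integrableOn_exp_mul_Ioi (a := -q) (by linarith) 0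
  have h2 := integral_exp_mul_Ioi (a := -q) (by linarith) 0
  simp only [neg_mul, mul_zero, Real.exp_zero] at h1 h2
  rw [← ofReal_integral_eq_lintegral_ofReal h1 (Eventually.of_forall fun t => Real.exp_nonneg _),
    h2]
  congr 1
  field_simp

/-- Under `u = e^{-t}` the Laplace transform at `q = n + 1` becomes the `n`-th moment of the image
of `e^{-t} v(t) dt` on `[0, 1]`. Integer `q` therefore suffice. -/
lemma ae_eq_const_of_laplace {v : ℝ → ℝ≥0∞} (hv : Measurable v) {M c : ℝ≥0∞} (hM : M ≠ ∞)
    (hc : c ≠ ∞) (hvM : ∀ t, v t ≤ M)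
    (h : ∀ q : ℝ, 0 < q → ENNReal.ofReal q *
      ∫⁻ t in Ioi 0, ENNReal.ofReal (Real.exp (-(q * t))) * v t = c) :
    ∀ᵐ t ∂volume.restrict (Ioi 0), v t = c := by
  set e : ℝ → ℝ≥0∞ := fun t => ENNReal.ofReal (Real.exp (-t)) with he
  have hem : Measurable e := by fun_prop
  set φ : ℝ → ℝ := fun t => Real.exp (-t) with hφ
  have hφm : Measurable φ := by fun_prop
  have hfin : ∀ {w : ℝ → ℝ≥0∞} {N : ℝ≥0∞}, N ≠ ∞ → (∀ t, w t ≤ N) →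
      ∫⁻ t in Ioi 0, e t * w t ≠ ∞ := by
    intro w N hN hw
    refine ne_top_of_le_ne_top ?_ (lintegral_mono fun t => mul_le_mul_right (hw t) (e t))
    rw [lintegral_mul_const _ hem]
    have := lintegral_exp_neg_mul one_pos
    simp only [one_mul] at this
    rw [this]
    exact ENNReal.mul_ne_top ENNReal.ofReal_ne_top hN
  set η : (ℝ → ℝ≥0∞) → Measure ℝ :=
    fun w => (volume.restrict (Ioi 0)).withDensity fun t => e t * w t with hη
  have hηfin : ∀ {w : ℝ → ℝ≥0∞} {N : ℝ≥0∞}, N ≠ ∞ → (∀ t, w t ≤ N) →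
      IsFiniteMeasure (η w) := fun hN hw => isFiniteMeasure_withDensity (hfin hN hw)
  have hsupp : ∀ w, ((η w).map φ) (Icc 0 1)ᶜ = 0 := by
    intro w
    rw [Measure.map_apply hφm measurableSet_Icc.compl]
    refine withDensity_absolutelyContinuous _ _ ?_
    have hms : MeasurableSet (φ ⁻¹' (Icc 0 1)ᶜ) := hφm measurableSet_Icc.compl
    rw [Measure.restrict_apply hms]
    convert measure_empty (μ := volume)
    refine eq_empty_of_forall_notMem ?_
    rintro t ⟨h1, h2⟩
    refine h1 ⟨Real.exp_nonneg _, Real.exp_le_one_iff.2 ?_⟩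
    have : 0 < t := h2
    linarith
  have hmom : ∀ {w : ℝ → ℝ≥0∞}, Measurable w → ∀ n : ℕ, ∫ x, x ^ n ∂(η w).map φ =
      (∫⁻ t in Ioi 0, ENNReal.ofReal (Real.exp (-((n + 1 : ℝ) * t))) * w t).toReal := by
    intro w hw n
    rw [integral_map hφm.aemeasurable (by fun_prop), integral_eq_lintegral_of_nonneg_ae
      (Eventually.of_forall fun t => pow_nonneg (Real.exp_nonneg _) n) (by fun_prop),
      lintegral_withDensity_eq_lintegral_mul _ (by fun_prop) (by fun_prop)]
    congr 1
    refine lintegral_congr fun t => ?_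
    simp only [Pi.mul_apply, he]
    rw [mul_right_comm, ← ENNReal.ofReal_mul (Real.exp_nonneg _), ← Real.exp_nat_mul,
      ← Real.exp_add]
    congr 3
    ring
  have hηv := hηfin hM hvM
  have hηc : IsFiniteMeasure (η fun _ => c) := hηfin hc fun _ => le_rfl
  have hmap : (η v).map φ = (η fun _ => c).map φ := by
    refine ext_of_moments (hsupp _) (hsupp _) fun n => ?_
    rw [hmom hv, hmom measurable_const]
    congr 1
    have hn : (0 : ℝ) < n + 1 := by positivity
    have hn' : ENNReal.ofReal (n + 1 : ℝ) ≠ 0 := (ENNReal.ofReal_pos.2 hn).ne'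
    refine (ENNReal.mul_right_inj hn' ENNReal.ofReal_ne_top).1 ?_
    rw [h _ hn, lintegral_mul_const _ (by fun_prop), lintegral_exp_neg_mul hn, ← mul_assoc,
      ← ENNReal.ofReal_mul hn.le, mul_inv_cancel₀ hn.ne', ENNReal.ofReal_one, one_mul]
  have hηeq : η v = η fun _ => c := by
    -- `-log` inverts `t ↦ e^{-t}`, so equality of the images pulls back to the half-line.
    have hlog : Measurable fun u : ℝ => -Real.log u := Real.measurable_log.neg
    have hid : (fun u : ℝ => -Real.log u) ∘ φ = id := by
      ext t
      simp [hφ]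
    have := congrArg (Measure.map fun u : ℝ => -Real.log u) hmap
    rwa [Measure.map_map hlog hφm, Measure.map_map hlog hφm, hid, Measure.map_id,
      Measure.map_id] at this
  have h2 := (withDensity_eq_iff (by fun_prop) (by fun_prop) (hfin hM hvM)).1 hηeq
  filter_upwards [h2] with t ht
  exact (ENNReal.mul_right_inj (ENNReal.ofReal_pos.2 (Real.exp_pos _)).ne'
    ENNReal.ofReal_ne_top).1 ht

lemma eq_of_ae_eq_of_rightContinuous {v : ℝ → ℝ≥0∞} {c : ℝ≥0∞}
    (h : ∀ᵐ t ∂volume.restrict (Ioi 0), v t = c) {t : ℝ} (ht : 0 ≤ t)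
    (hv : Tendsto v (𝓝[>] t) (𝓝 (v t))) : v t = c := by
  refine isClosed_singleton.mem_of_frequently_of_tendsto (s := {c}) (f := v) (b := 𝓝[>] t) ?_ hv
  intro hev
  obtain ⟨b, hb, hsub⟩ := mem_nhdsGT_iff_exists_Ioo_subset.1 hev
  rw [ae_restrict_iff' measurableSet_Ioi, ae_iff] at h
  have hnull : volume (Ioo t b) = 0 := by
    refine measure_mono_null (fun s hs => ?_) h
    have h1 : ¬ v s ∈ ({c} : Set ℝ≥0∞) := hsub hs
    intro h2
    exact h1 (h2 (ht.trans_lt hs.1))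
  have hb' : t < b := hb
  simp [Real.volume_Ioo] at hnull
  linarith

/-! ### The resolvent -/

variable (lam a γ : Fin 2 → ℝ)

/-- The expectation of `f (X(t), ε(t))` when `(X(0), ε(0)) = z`. -/
noncomputable def evolve (f : ℝ × Fin 2 → ℝ≥0∞) (t : ℝ) (z : ℝ × Fin 2) : ℝ≥0∞ :=
  ∫⁻ ω, f (stateAt lam a γ t (z, ω)) ∂clockLaw

/-- The resolvent of the transition semigroup. -/
noncomputable def resolvent (q : ℝ) (f : ℝ × Fin 2 → ℝ≥0∞) (z : ℝ × Fin 2) : ℝ≥0∞ :=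
  ∫⁻ t in Ioi 0, ENNReal.ofReal (Real.exp (-(q * t))) * evolve lam a γ f t z

/-- The resolvent of the motion in state `i`, killed at the first switch. -/
noncomputable def killedResolvent (q : ℝ) (i : Fin 2) (h : ℝ → ℝ≥0∞) (x : ℝ) : ℝ≥0∞ :=
  ∫⁻ t in Ioi 0, ENNReal.ofReal (Real.exp (-((q + lam i) * t))) * h (flow a γ i t x)

lemma measurable_flow (i : Fin 2) : Measurable fun p : ℝ × ℝ => flow a γ i p.1 p.2 := by
  unfold flow
  refine Measurable.add (by fun_prop) ?_
  exact measurable_integral_zero (f := fun q : (ℝ × ℝ) × ℝ =>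
    a i * Real.exp (-(γ i * q.1.1 - γ i * q.2))) (by fun_prop) measurable_fst

variable {lam a γ}

lemma measurable_evolve {f : ℝ × Fin 2 → ℝ≥0∞} (hf : Measurable f) :
    Measurable fun p : ℝ × (ℝ × Fin 2) => evolve lam a γ f p.1 p.2 := by
  refine Measurable.lintegral_prod_right' (f := fun q : (ℝ × (ℝ × Fin 2)) × (ℕ → ℝ) =>
    f (stateAt lam a γ q.1.1 (q.1.2, q.2))) ?_
  exact hf.comp ((measurable_stateAt_time lam a γ).comp
    (f := fun q : (ℝ × (ℝ × Fin 2)) × (ℕ → ℝ) => (q.1.1, (q.1.2, q.2))) (by fun_prop))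

lemma measurable_resolvent (q : ℝ) {f : ℝ × Fin 2 → ℝ≥0∞} (hf : Measurable f) :
    Measurable (resolvent lam a γ q f) := by
  have := measurable_evolve (lam := lam) (a := a) (γ := γ) hf
  refine Measurable.lintegral_prod_right' (f := fun p : (ℝ × Fin 2) × ℝ =>
    ENNReal.ofReal (Real.exp (-(q * p.2))) * evolve lam a γ f p.2 p.1) ?_
  exact Measurable.mul (by fun_prop) (this.comp
    (f := fun p : (ℝ × Fin 2) × ℝ => (p.2, p.1)) (by fun_prop))

lemma measurable_killedResolvent (q : ℝ) (i : Fin 2) {h : ℝ → ℝ≥0∞} (hh : Measurable h) :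
    Measurable (killedResolvent lam a γ q i h) := by
  refine Measurable.lintegral_prod_right' (f := fun p : ℝ × ℝ =>
    ENNReal.ofReal (Real.exp (-((q + lam i) * p.2))) * h (flow a γ i p.2 p.1)) ?_
  exact Measurable.mul (by fun_prop) (hh.comp ((measurable_flow a γ i).comp
    (f := fun p : ℝ × ℝ => (p.2, p.1)) (by fun_prop)))

lemma evolve_le {f : ℝ × Fin 2 → ℝ≥0∞} {M : ℝ≥0∞} (hM : ∀ z, f z ≤ M) (t : ℝ) (z : ℝ × Fin 2) :
    evolve lam a γ f t z ≤ M :=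
  (lintegral_mono fun _ => hM _).trans (by simp)

lemma resolvent_le {q : ℝ} (hq : 0 < q) {f : ℝ × Fin 2 → ℝ≥0∞} {M : ℝ≥0∞} (hM : ∀ z, f z ≤ M)
    (z : ℝ × Fin 2) : resolvent lam a γ q f z ≤ ENNReal.ofReal q⁻¹ * M := by
  refine (lintegral_mono fun t => mul_le_mul_right (evolve_le hM t z) _).trans ?_
  rw [lintegral_mul_const _ (by fun_prop), lintegral_exp_neg_mul hq]

/-- Decomposition of the expectation at the first switch. -/
lemma evolve_eq (hlam : ∀ i, 0 < lam i) {f : ℝ × Fin 2 → ℝ≥0∞} (hf : Measurable f)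
    {t : ℝ} (ht : 0 < t) (x : ℝ) (i : Fin 2) :
    evolve lam a γ f t (x, i) = ∫⁻ s in Ioi 0, ENNReal.ofReal (lam i * Real.exp (-(lam i * s))) *
      (if t < s then f (flow a γ i t x, i)
        else evolve lam a γ f (t - s) (flow a γ i s x, i + 1)) := by
  have hflow := measurable_flow a γ i
  have hflow' : Measurable fun s => flow a γ i s x :=
    hflow.comp (f := fun s : ℝ => (s, x)) measurable_prodMk_right
  have hev := measurable_evolve (lam := lam) (a := a) (γ := γ) hf
  have hFm : Measurable fun s => if t < s then f (flow a γ i t x, i)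
        else evolve lam a γ f (t - s) (flow a γ i s x, i + 1) :=
    Measurable.ite measurableSet_Ioi measurable_const
      (hev.comp (f := fun s : ℝ => (t - s, (flow a γ i s x, i + 1))) (by fun_prop))
  -- The integrand is written through the first clock and the shifted clocks, which are independent.
  set G : ℝ × (ℕ → ℝ) → ℝ≥0∞ := fun p => if t < p.1 / lam i then f (flow a γ i t x, i)
    else f (stateAt lam a γ (t - p.1 / lam i) ((flow a γ i (p.1 / lam i) x, i + 1), p.2)) with hG
  have hGm : Measurable G := by
    refine Measurable.ite (measurableSet_lt measurable_const (by fun_prop)) measurable_const ?_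
    refine hf.comp ((measurable_stateAt_time lam a γ).comp (f := fun p : ℝ × (ℕ → ℝ) =>
      (t - p.1 / lam i, ((flow a γ i (p.1 / lam i) x, i + 1), p.2))) ?_)
    have : Measurable fun p : ℝ × (ℕ → ℝ) => flow a γ i (p.1 / lam i) x :=
      hflow'.comp (by fun_prop)
    fun_prop
  have h1 : evolve lam a γ f t (x, i) = ∫⁻ ω, G (ω 0, shift ω) ∂clockLaw := by
    refine lintegral_congr_ae ?_
    filter_upwards [ae_regular] with ω hω
    simp only [hG, stateAt]
    split_ifs with hlt
    · rw [process_of_le hlam hω a γ x ht.le hlt.le, chain_of_lt hlam hω hlt]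
    · rw [process_of_ge hlam hω a γ x (not_lt.1 hlt), chain_of_ge hlam hω (not_lt.1 hlt)]
  rw [h1, lintegral_clockLaw hGm, ← lintegral_expMeasure_div (hlam i) hFm]
  refine lintegral_congr fun u => ?_
  simp only [hG]
  split_ifs
  · simp
  · rfl

lemma lintegral_exp_neg_mul_Ioi {c : ℝ} (hc : 0 < c) (t : ℝ) :
    ∫⁻ s in Ioi t, ENNReal.ofReal (c * Real.exp (-(c * s))) =
      ENNReal.ofReal (Real.exp (-(c * t))) := by
  have h1 := (integrableOn_exp_mul_Ioi (a := -c) (by linarith) t).const_mul c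
  have h2 := integral_exp_mul_Ioi (a := -c) (by linarith) t
  simp only [neg_mul] at h1 h2
  rw [← ofReal_integral_eq_lintegral_ofReal h1
    (Eventually.of_forall fun t => mul_nonneg hc.le (Real.exp_nonneg _)), integral_const_mul, h2]
  congr 1
  field_simp

lemma lintegral_Ioi_shift {F : ℝ → ℝ≥0∞} (s : ℝ) :
    ∫⁻ t in Ioi s, F (t - s) = ∫⁻ r in Ioi 0, F r := by
  have h0 := lintegral_sub_right_eq_self (μ := volume) ((Ioi 0).indicator F) s
  rw [← lintegral_indicator measurableSet_Ioi, ← lintegral_indicator measurableSet_Ioi, ← h0]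
  refine lintegral_congr fun t => ?_
  by_cases h : s < t <;> simp [indicator, h]

/-- The resolvent equation obtained from the first switch. -/
lemma resolvent_eq (hlam : ∀ i, 0 < lam i) {f : ℝ × Fin 2 → ℝ≥0∞} (hf : Measurable f) (q : ℝ)
    (x : ℝ) (i : Fin 2) :
    resolvent lam a γ q f (x, i) = killedResolvent lam a γ q i
      (fun y => f (y, i) + ENNReal.ofReal (lam i) * resolvent lam a γ q f (y, i + 1)) x := by
  have hflow := measurable_flow a γ i
  have hflow' : Measurable fun s => flow a γ i s x :=
    hflow.comp (f := fun s : ℝ => (s, x)) measurable_prodMk_right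
  have hev := measurable_evolve (lam := lam) (a := a) (γ := γ) hf
  have hevm : Measurable fun p : ℝ × ℝ =>
      evolve lam a γ f (p.1 - p.2) (flow a γ i p.2 x, i + 1) := by
    have : Measurable fun p : ℝ × ℝ => flow a γ i p.2 x := hflow'.comp measurable_snd
    exact hev.comp (f := fun p : ℝ × ℝ => (p.1 - p.2, (flow a γ i p.2 x, i + 1))) (by fun_prop)
  set d : ℝ → ℝ≥0∞ := fun s => ENNReal.ofReal (lam i * Real.exp (-(lam i * s))) with hd
  have hdm : Measurable d := by fun_prop
  set k : ℝ → ℝ≥0∞ := fun t => ENNReal.ofReal (Real.exp (-(q * t))) with hk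
  have hkm : Measurable k := by fun_prop
  -- No switch before `t` has probability `e^{-lam i * t}`, which is the killing factor; switches at
  -- `s < t` stay as a double integral.
  have hsplit : ∀ t ∈ Ioi (0 : ℝ), k t * evolve lam a γ f t (x, i) =
      ENNReal.ofReal (Real.exp (-((q + lam i) * t))) * f (flow a γ i t x, i) +
        ∫⁻ s in Ioi 0, k t * (d s * (if s < t then
          evolve lam a γ f (t - s) (flow a γ i s x, i + 1) else 0)) := by
    intro t ht
    have ht' : 0 < t := ht
    have hm : Measurable fun s => d s * (if s < t then
        evolve lam a γ f (t - s) (flow a γ i s x, i + 1) else 0) :=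
      hdm.mul (Measurable.ite measurableSet_Iio
        (hevm.comp (f := fun s : ℝ => (t, s)) measurable_prodMk_left) measurable_const)
    rw [lintegral_const_mul _ hm, evolve_eq hlam hf ht' x i]
    have h1 : ∫⁻ s in Ioi 0, d s * (if t < s then f (flow a γ i t x, i)
        else evolve lam a γ f (t - s) (flow a γ i s x, i + 1)) =
        (∫⁻ s in Ioi 0, (Ioi t).indicator d s * f (flow a γ i t x, i)) +
          ∫⁻ s in Ioi 0, d s * (if s < t then
            evolve lam a γ f (t - s) (flow a γ i s x, i + 1) else 0) := by
      rw [← lintegral_add_right _ hm]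
      refine lintegral_congr_ae ?_
      have h0 : ∀ᵐ s : ℝ, s ≠ t := by simp [ae_iff]
      filter_upwards [ae_restrict_of_ae h0] with s hs
      rcases lt_or_gt_of_ne hs with hs | hs
      · simp [hs, not_lt.2 hs.le]
      · simp [hs, not_lt.2 hs.le]
    rw [h1, mul_add, lintegral_mul_const _ (hdm.indicator measurableSet_Ioi),
      setLIntegral_indicator measurableSet_Ioi, Ioi_inter_Ioi, max_eq_left ht'.le,
      lintegral_exp_neg_mul_Ioi (hlam i), ← mul_assoc, hk, ← ENNReal.ofReal_mul
      (Real.exp_nonneg _), ← Real.exp_add]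
    congr 4
    ring
  have hm2 : Measurable fun p : ℝ × ℝ => k p.1 * (d p.2 * (if p.2 < p.1 then
      evolve lam a γ f (p.1 - p.2) (flow a γ i p.2 x, i + 1) else 0)) :=
    (hkm.comp measurable_fst).mul ((hdm.comp measurable_snd).mul
      (Measurable.ite (measurableSet_lt measurable_snd measurable_fst) hevm measurable_const))
  have hfm : Measurable fun t =>
      ENNReal.ofReal (Real.exp (-((q + lam i) * t))) * f (flow a γ i t x, i) := by
    have : Measurable fun t => f (flow a γ i t x, i) := hf.comp (by fun_prop)
    fun_prop
  rw [resolvent, setLIntegral_congr_fun measurableSet_Ioi hsplit, lintegral_add_left hfm,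
    lintegral_lintegral_swap hm2.aemeasurable, killedResolvent, ← lintegral_add_left hfm]
  refine setLIntegral_congr_fun measurableSet_Ioi fun s hs => ?_
  have hs' : 0 < s := hs
  have hmE : Measurable fun t => k t * evolve lam a γ f t (flow a γ i s x, i + 1) :=
    hkm.mul (hev.comp (f := fun t : ℝ => (t, (flow a γ i s x, i + 1))) measurable_prodMk_right)
  -- Counting time from the switch and using `k t = k s * k (t - s)`, the inner integral is the
  -- resolvent at the position of the switch.
  have h2 : ∫⁻ t in Ioi 0, k t * (d s * (if s < t then
      evolve lam a γ f (t - s) (flow a γ i s x, i + 1) else 0)) =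
      d s * k s * resolvent lam a γ q f (flow a γ i s x, i + 1) := by
    have h4 : ∫⁻ t in Ioi s, d s * k s * (k (t - s) *
        evolve lam a γ f (t - s) (flow a γ i s x, i + 1)) =
        d s * k s * resolvent lam a γ q f (flow a γ i s x, i + 1) := by
      have hmE' : Measurable fun t =>
          k (t - s) * evolve lam a γ f (t - s) (flow a γ i s x, i + 1) :=
        hmE.comp (measurable_id.sub_const s)
      rw [lintegral_const_mul _ hmE', resolvent, lintegral_Ioi_shift
        (F := fun t => k t * evolve lam a γ f t (flow a γ i s x, i + 1)) s]
    rw [← h4, ← max_eq_left hs'.le, ← Ioi_inter_Ioi,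
      ← setLIntegral_indicator measurableSet_Ioi, max_eq_left hs'.le]
    refine lintegral_congr fun t => ?_
    by_cases h : s < t
    · rw [indicator_of_mem (mem_Ioi.2 h), if_pos h]
      have : k t = k s * k (t - s) := by
        simp only [hk]
        rw [← ENNReal.ofReal_mul (Real.exp_nonneg _), ← Real.exp_add]
        congr 2
        ring
      rw [this]
      ring
    · rw [indicator_of_notMem (by simpa using h), if_neg h, mul_zero, mul_zero]
  have h3 : d s * k s =
      ENNReal.ofReal (Real.exp (-((q + lam i) * s))) * ENNReal.ofReal (lam i) := by
    simp only [hd, hk]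
    rw [← ENNReal.ofReal_mul (mul_nonneg (hlam i).le (Real.exp_nonneg _)),
      ← ENNReal.ofReal_mul (Real.exp_nonneg _), mul_assoc, ← Real.exp_add, mul_comm]
    congr 3
    ring
  rw [h2, h3, mul_add, mul_assoc]

/-! ### A criterion for invariance -/

/-- Almost every path is continuous in position and right continuous in state; dominated convergence
transfers this. -/
lemma tendsto_evolve_right (hlam : ∀ i, 0 < lam i) {μ : Measure (ℝ × Fin 2)}
    [IsFiniteMeasure μ] {f : ℝ × Fin 2 → ℝ≥0∞} (hf : Continuous f) {M : ℝ≥0∞} (hM : M ≠ ∞)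
    (hfM : ∀ z, f z ≤ M) (t : ℝ) :
    Tendsto (fun s => ∫⁻ p, f (stateAt lam a γ s p) ∂μ.prod clockLaw) (𝓝[>] t)
      (𝓝 (∫⁻ p, f (stateAt lam a γ t p) ∂μ.prod clockLaw)) := by
  refine tendsto_lintegral_filter_of_dominated_convergence (fun _ => M)
    (Eventually.of_forall fun s => hf.measurable.comp (measurable_stateAt lam a γ s))
    (Eventually.of_forall fun s => Eventually.of_forall fun p => hfM _) ?_ ?_
  · simpa using ENNReal.mul_ne_top hM (measure_ne_top (μ.prod clockLaw) univ)
  · have hreg : ∀ᵐ p ∂μ.prod clockLaw, Regular p.2 :=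
      Measure.quasiMeasurePreserving_snd.ae ae_regular
    filter_upwards [hreg] with p hp
    refine (hf.tendsto _).comp (Tendsto.prodMk_nhds ?_ ?_)
    · exact ((continuous_process lam a γ p.1.1 p.1.2 p.2).tendsto t).mono_left nhdsWithin_le_nhds
    · refine tendsto_const_nhds.congr' ?_
      filter_upwards [nhdsWithin_mono t Ioi_subset_Ici_self
        (chain_eventually_eq hlam hp p.1.2 t)] with s hs
      exact hs.symm

/-- The measure `μ` with parts `m i` on `ℝ × {i}` is invariant if `m i` is the law of the position
at an exponential time of the motion fed by `m i` and by the switches from the other state. -/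
theorem isInvariant_of_killedResolvent (hlam : ∀ i, 0 < lam i) {μ : Measure (ℝ × Fin 2)}
    [IsFiniteMeasure μ] {m : Fin 2 → Measure ℝ} [∀ i, IsFiniteMeasure (m i)]
    (hμ : ∀ f : ℝ × Fin 2 → ℝ≥0∞, Measurable f → ∫⁻ z, f z ∂μ = ∑ i, ∫⁻ x, f (x, i) ∂m i)
    (hm : ∀ q : ℝ, 0 < q → ∀ i, ∀ h : ℝ → ℝ≥0∞, Measurable h →
      ENNReal.ofReal q * ∫⁻ x, killedResolvent lam a γ q i h x ∂m i +
        ENNReal.ofReal (lam (i + 1)) * ∫⁻ x, killedResolvent lam a γ q i h x ∂m (i + 1) =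
      ∫⁻ x, h x ∂m i) :
    IsInvariant lam a γ μ := by
  have hres : ∀ f : ℝ × Fin 2 → ℝ≥0∞, Measurable f → ∀ M : ℝ≥0∞, M ≠ ∞ → (∀ z, f z ≤ M) →
      ∀ q : ℝ, 0 < q → ENNReal.ofReal q * ∫⁻ z, resolvent lam a γ q f z ∂μ = ∫⁻ z, f z ∂μ := by
    intro f hf M hM hfM q hq
    have hRm := measurable_resolvent (lam := lam) (a := a) (γ := γ) q hf
    have hRi : ∀ i, Measurable fun y => resolvent lam a γ q f (y, i) := fun i =>
      hRm.comp measurable_prodMk_right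
    have hfi : ∀ i, Measurable fun y => f (y, i) := fun i => hf.comp measurable_prodMk_right
    have hfin : ∀ i j, ENNReal.ofReal (lam i) *
        ∫⁻ x, resolvent lam a γ q f (x, j) ∂m i ≠ ∞ := by
      intro i j
      refine ENNReal.mul_ne_top ENNReal.ofReal_ne_top
        (ne_top_of_le_ne_top ?_ (lintegral_mono fun x => resolvent_le hq hfM (x, j)))
      rw [lintegral_const]
      exact ENNReal.mul_ne_top (ENNReal.mul_ne_top ENNReal.ofReal_ne_top hM)
        (measure_ne_top _ _)
    have key : ∀ i, ENNReal.ofReal q * ∫⁻ x, resolvent lam a γ q f (x, i) ∂m i +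
        ENNReal.ofReal (lam (i + 1)) * ∫⁻ x, resolvent lam a γ q f (x, i) ∂m (i + 1) =
        ∫⁻ x, f (x, i) ∂m i +
          ENNReal.ofReal (lam i) * ∫⁻ x, resolvent lam a γ q f (x, i + 1) ∂m i := by
      intro i
      -- This test function is chosen so that its killed resolvent is the full resolvent, by the
      -- first-switch equation.
      have h1 := hm q hq i
        (fun y => f (y, i) + ENNReal.ofReal (lam i) * resolvent lam a γ q f (y, i + 1))
        ((hfi i).add ((hRi (i + 1)).const_mul _))
      simp only [← resolvent_eq hlam hf q _ i] at h1
      rw [h1, lintegral_add_left (hfi i), lintegral_const_mul _ (hRi (i + 1))]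
    have k0 := key 0
    have k1 := key 1
    rw [show (0 : Fin 2) + 1 = 1 from rfl] at k0
    rw [show (1 : Fin 2) + 1 = 0 from rfl] at k1
    rw [hμ _ hRm, hμ _ hf, Fin.sum_univ_two, Fin.sum_univ_two, mul_add]
    have hf1 := hfin 1 0
    have hf0 := hfin 0 1
    -- Summed over both states, the switching terms occur on both sides; cancelling them in `ℝ≥0∞`
    -- requires their finiteness.
    refine (ENNReal.add_left_inj (ENNReal.add_ne_top.2 ⟨hf1, hf0⟩)).1 ?_
    calc _ = (ENNReal.ofReal q * ∫⁻ x, resolvent lam a γ q f (x, 0) ∂m 0 +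
          ENNReal.ofReal (lam 1) * ∫⁻ x, resolvent lam a γ q f (x, 0) ∂m 1) +
          (ENNReal.ofReal q * ∫⁻ x, resolvent lam a γ q f (x, 1) ∂m 1 +
          ENNReal.ofReal (lam 0) * ∫⁻ x, resolvent lam a γ q f (x, 1) ∂m 0) := by ring
      _ = _ := by rw [k0, k1]; ring
  rw [isInvariant_iff]
  intro t ht
  have hfinite : IsFiniteMeasure ((μ.prod clockLaw).map (stateAt lam a γ t)) :=
    inferInstance
  refine ext_of_forall_lintegral_eq_of_IsFiniteMeasure fun g => ?_
  set f : ℝ × Fin 2 → ℝ≥0∞ := fun z => g z with hfdef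
  have hfc : Continuous f := ENNReal.continuous_coe.comp g.continuous
  have hf : Measurable f := hfc.measurable
  obtain ⟨M, hM, hfM⟩ : ∃ M : ℝ≥0∞, M ≠ ∞ ∧ ∀ z, f z ≤ M := by
    refine ⟨(nndist g 0 : ℝ≥0∞), ENNReal.coe_ne_top, fun z => ENNReal.coe_le_coe.2 ?_⟩
    simpa using BoundedContinuousFunction.NNReal.upper_bound g z
  set v : ℝ → ℝ≥0∞ := fun s => ∫⁻ z, evolve lam a γ f s z ∂μ with hv
  have hev := measurable_evolve (lam := lam) (a := a) (γ := γ) hf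
  have hvm : Measurable v := Measurable.lintegral_prod_right'
    (f := fun p : ℝ × (ℝ × Fin 2) => evolve lam a γ f p.1 p.2) hev
  have hv_eq : ∀ s, v s = ∫⁻ p, f (stateAt lam a γ s p) ∂μ.prod clockLaw := fun s =>
    (lintegral_prod _ (hf.comp (measurable_stateAt lam a γ s)).aemeasurable).symm
  have hvM : ∀ s, v s ≤ M * μ univ := fun s =>
    (lintegral_mono fun z => evolve_le hfM s z).trans (by simp)
  have hae : ∀ᵐ s ∂volume.restrict (Ioi 0), v s = ∫⁻ z, f z ∂μ := by
    refine ae_eq_const_of_laplace hvm (M := M * μ univ)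
      (ENNReal.mul_ne_top hM (measure_ne_top _ _)) ?_ hvM fun q hq => ?_
    · refine ne_top_of_le_ne_top ?_ (lintegral_mono hfM)
      simpa using ENNReal.mul_ne_top hM (measure_ne_top μ univ)
    · rw [← hres f hf M hM hfM q hq]
      congr 1
      have hm2 : Measurable fun p : (ℝ × Fin 2) × ℝ =>
          ENNReal.ofReal (Real.exp (-(q * p.2))) * evolve lam a γ f p.2 p.1 :=
        Measurable.mul (by fun_prop) (hev.comp
          (f := fun p : (ℝ × Fin 2) × ℝ => (p.2, p.1)) (by fun_prop))
      simp only [resolvent]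
      rw [lintegral_lintegral_swap hm2.aemeasurable]
      refine lintegral_congr fun s => ?_
      have hevs : Measurable fun z => evolve lam a γ f s z :=
        hev.comp (f := fun z : ℝ × Fin 2 => (s, z)) measurable_prodMk_left
      rw [lintegral_const_mul _ hevs]
  have hright : Tendsto v (𝓝[>] t) (𝓝 (v t)) := by
    simp only [funext hv_eq]
    exact tendsto_evolve_right hlam hfc hM hfM t
  have := eq_of_ae_eq_of_rightContinuous hae ht hright
  rw [hv_eq] at this
  rw [lintegral_map hf (measurable_stateAt lam a γ t), this]

end

section

/-! ### The explicit density -/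

variable {lam a γ : Fin 2 → ℝ}

/-- The explicit density as a function of the distance to the rest point. -/
noncomputable def profile (lam γ : Fin 2 → ℝ) : Fin 2 → ℝ → ℝ :=
  ![fun y => normConst lam (lam 0 / γ 0) * y ^ (lam 0 / γ 0 - 1) * Real.exp (-lam 1 * y),
    fun y => γ 0 * normConst lam (lam 0 / γ 0) * y ^ (lam 0 / γ 0) * Real.exp (-lam 1 * y)]

lemma normConst_pos (hlam : ∀ i, 0 < lam i) {α : ℝ} (hα : 0 < α) : 0 < normConst lam α :=
  div_pos (Real.rpow_pos_of_pos (hlam 1) _)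
    (mul_pos (add_pos (hlam 0) (hlam 1)) (Real.Gamma_pos_of_pos hα))

lemma measurable_profile (i : Fin 2) : Measurable (profile lam γ i) := by
  fin_cases i <;> simp only [profile] <;> dsimp <;> fun_prop

lemma profile_nonneg (hlam : ∀ i, 0 < lam i) (hγ0 : 0 < γ 0) (i : Fin 2) {y : ℝ} (hy : 0 < y) :
    0 ≤ profile lam γ i y := by
  have := normConst_pos hlam (div_pos (hlam 0) hγ0)
  fin_cases i <;> simp only [profile] <;> dsimp <;> positivity

lemma lintegral_Ioi_comp_mul {c : ℝ} (hc : 0 < c) {F : ℝ → ℝ≥0∞} (hF : Measurable F) :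
    ∫⁻ y in Ioi 0, F y = ∫⁻ z in Ioi 0, ENNReal.ofReal c * F (c * z) := by
  rw [← lintegral_indicator measurableSet_Ioi, ← lintegral_indicator measurableSet_Ioi]
  have hFi : Measurable fun z => (Ioi 0).indicator F (c * z) :=
    (hF.indicator measurableSet_Ioi).comp (by fun_prop)
  conv_lhs => rw [← Real.smul_map_volume_mul_left hc.ne']
  rw [lintegral_smul_measure, lintegral_map (hF.indicator measurableSet_Ioi) (by fun_prop),
    smul_eq_mul, ← lintegral_const_mul _ hFi, abs_of_pos hc]
  refine lintegral_congr fun z => ?_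
  by_cases hz : 0 < z <;> simp [indicator, hz, hc]

lemma lintegral_Ioi_of_hasDerivAt {g g' : ℝ → ℝ} {l : ℝ}
    (hd : ∀ t ∈ Ici (0 : ℝ), HasDerivAt g (g' t) t) (hpos : ∀ t ∈ Ioi (0 : ℝ), 0 ≤ g' t)
    (hl : Tendsto g atTop (𝓝 l)) :
    ∫⁻ t in Ioi 0, ENNReal.ofReal (g' t) = ENNReal.ofReal (l - g 0) := by
  rw [← integral_Ioi_of_hasDerivAt_of_nonneg' hd hpos hl,
    ofReal_integral_eq_lintegral_ofReal (integrableOn_Ioi_deriv_of_nonneg' hd hpos hl)]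
  exact (ae_restrict_iff' measurableSet_Ioi).2 (Eventually.of_forall hpos)

/-- Differentiability is asked only in the open interval: in the application the derivative contains
`(z - t)^{α - 1}`, unbounded at `z` when `α < 1`. Its sign gives integrability. -/
lemma lintegral_Ioo_of_hasDerivAt {g g' : ℝ → ℝ} {z : ℝ} (hz : 0 ≤ z)
    (hc : ContinuousOn g (Icc 0 z)) (hd : ∀ t ∈ Ioo 0 z, HasDerivAt g (g' t) t)
    (hpos : ∀ t ∈ Ioo 0 z, 0 ≤ g' t) :
    ∫⁻ t in Ioo 0 z, ENNReal.ofReal (g' t) = ENNReal.ofReal (g z - g 0) := by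
  have hi := intervalIntegral.integrableOn_deriv_of_nonneg hc hd hpos
  have hi' : IntervalIntegrable g' volume 0 z := (intervalIntegrable_iff_integrableOn_Ioc_of_le hz).2 hi
  rw [← intervalIntegral.integral_eq_sub_of_hasDerivAt_of_le hz hc hd hi',
    intervalIntegral.integral_of_le hz, integral_Ioc_eq_integral_Ioo,
    ofReal_integral_eq_lintegral_ofReal (hi.mono_set Ioo_subset_Ioc_self)]
  exact (ae_restrict_iff' measurableSet_Ioo).2 (Eventually.of_forall hpos)

/-- Balance of the profile under the motion in state `0`. -/
lemma profile_balance_zero (hlam : ∀ i, 0 < lam i) (hγ0 : 0 < γ 0) {q : ℝ} (hq : 0 < q)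
    {H : ℝ → ℝ≥0∞} (hH : Measurable H) :
    ∫⁻ y in Ioi 0, ENNReal.ofReal (q * profile lam γ 0 y + lam 1 * profile lam γ 1 y) *
      ∫⁻ t in Ioi 0, ENNReal.ofReal (Real.exp (-((q + lam 0) * t))) *
        H (Real.exp (-(γ 0 * t)) * y) =
    ∫⁻ z in Ioi 0, ENNReal.ofReal (profile lam γ 0 z) * H z := by
  set P : ℝ → ℝ := fun y => q * profile lam γ 0 y + lam 1 * profile lam γ 1 y with hP
  have hp0 := measurable_profile (lam := lam) (γ := γ) 0
  have hp1 := measurable_profile (lam := lam) (γ := γ) 1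
  have hPm : Measurable P := by fun_prop
  have h1 : ∀ y, ENNReal.ofReal (P y) * ∫⁻ t in Ioi 0,
      ENNReal.ofReal (Real.exp (-((q + lam 0) * t))) * H (Real.exp (-(γ 0 * t)) * y) =
      ∫⁻ t in Ioi 0, ENNReal.ofReal (P y) * (ENNReal.ofReal (Real.exp (-((q + lam 0) * t))) *
        H (Real.exp (-(γ 0 * t)) * y)) := fun y =>
    (lintegral_const_mul _ (by fun_prop)).symm
  have h2 : ∀ t ∈ Ioi (0 : ℝ), ∫⁻ y in Ioi 0, ENNReal.ofReal (P y) *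
      (ENNReal.ofReal (Real.exp (-((q + lam 0) * t))) * H (Real.exp (-(γ 0 * t)) * y)) =
      ∫⁻ z in Ioi 0, ENNReal.ofReal (Real.exp (γ 0 * t) * P (Real.exp (γ 0 * t) * z) *
        Real.exp (-((q + lam 0) * t))) * H z := by
    intro t _
    -- The substitution `y = e^{γ₀ t} z` undoes the contraction, leaving `H` at `z`.
    rw [lintegral_Ioi_comp_mul (Real.exp_pos (γ 0 * t)) (by fun_prop)]
    refine lintegral_congr fun z => ?_
    rw [← mul_assoc (Real.exp (-(γ 0 * t))), ← Real.exp_add, neg_add_cancel, Real.exp_zero,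
      one_mul, ENNReal.ofReal_mul' (Real.exp_nonneg _), ENNReal.ofReal_mul (Real.exp_nonneg _)]
    ring
  refine (lintegral_congr h1).trans ?_
  rw [lintegral_lintegral_swap (Measurable.aemeasurable (by fun_prop)),
    setLIntegral_congr_fun measurableSet_Ioi h2,
    lintegral_lintegral_swap (Measurable.aemeasurable (by fun_prop))]
  refine setLIntegral_congr_fun measurableSet_Ioi fun z hz => ?_
  have hz' : 0 < z := hz
  rw [lintegral_mul_const _ (by fun_prop)]
  congr 1
  set C := normConst lam (lam 0 / γ 0) with hC
  have hCpos : 0 < C := normConst_pos hlam (div_pos (hlam 0) hγ0)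
  -- `g t` is minus `profile 0` transported along the motion, `e^{γ₀ t} π₀(e^{γ₀ t} z) e^{-(q + λ₀)
  -- t}`; as `γ₀ α = λ₀`, the factors `e^{± λ₀ t}` cancel. It rises from `-π₀(z)` to `0`.
  set g : ℝ → ℝ := fun t => -(C * z ^ (lam 0 / γ 0 - 1) *
    (Real.exp (-(q * t)) * Real.exp (-(lam 1 * z * Real.exp (γ 0 * t))))) with hg
  set g' : ℝ → ℝ := fun t => C * z ^ (lam 0 / γ 0 - 1) * (q + lam 1 * z * γ 0 *
    Real.exp (γ 0 * t)) * (Real.exp (-(q * t)) * Real.exp (-(lam 1 * z * Real.exp (γ 0 * t))))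
    with hg'
  have hd : ∀ t ∈ Ici (0 : ℝ), HasDerivAt g (g' t) t := by
    intro t _
    have e1 : HasDerivAt (fun t => Real.exp (-(q * t))) (Real.exp (-(q * t)) * (-(q * 1))) t :=
      ((hasDerivAt_id t).const_mul q).neg.exp
    have e2 : HasDerivAt (fun t => Real.exp (γ 0 * t)) (Real.exp (γ 0 * t) * (γ 0 * 1)) t :=
      ((hasDerivAt_id t).const_mul (γ 0)).exp
    have e3 : HasDerivAt (fun t => Real.exp (-(lam 1 * z * Real.exp (γ 0 * t))))
        (Real.exp (-(lam 1 * z * Real.exp (γ 0 * t))) *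
          (-(lam 1 * z * (Real.exp (γ 0 * t) * (γ 0 * 1))))) t :=
      (e2.const_mul (lam 1 * z)).neg.exp
    refine (((e1.mul e3).const_mul (C * z ^ (lam 0 / γ 0 - 1))).neg).congr_deriv ?_
    simp only [hg']
    ring
  have hpos : ∀ t ∈ Ioi (0 : ℝ), 0 ≤ g' t := by
    intro t _
    have := hlam 1
    simp only [hg']
    positivity
  have hl : Tendsto g atTop (𝓝 0) := by
    have l1 : Tendsto (fun t => Real.exp (-(q * t))) atTop (𝓝 0) :=
      Real.tendsto_exp_neg_atTop_nhds_zero.comp (tendsto_id.const_mul_atTop hq)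
    have l2 : Tendsto (fun t => Real.exp (-(lam 1 * z * Real.exp (γ 0 * t)))) atTop (𝓝 0) :=
      Real.tendsto_exp_neg_atTop_nhds_zero.comp
        ((Real.tendsto_exp_atTop.comp (tendsto_id.const_mul_atTop hγ0)).const_mul_atTop
          (mul_pos (hlam 1) hz'))
    simpa using ((l1.mul l2).const_mul (C * z ^ (lam 0 / γ 0 - 1))).neg
  have key := lintegral_Ioi_of_hasDerivAt hd hpos hl
  have h0 : 0 - g 0 = profile lam γ 0 z := by
    simp [hg, profile, hC]
  rw [h0] at key
  rw [← key]
  refine lintegral_congr fun t => ?_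
  congr 1
  have hαγ : γ 0 * (lam 0 / γ 0) = lam 0 := by field_simp
  have r1 : (Real.exp (γ 0 * t) * z) ^ (lam 0 / γ 0) =
      Real.exp (lam 0 * t) * (z ^ (lam 0 / γ 0 - 1) * z) := by
    rw [Real.mul_rpow (Real.exp_nonneg _) hz'.le, ← Real.exp_mul, ← Real.rpow_add_one hz'.ne']
    congr 2
    · rw [← hαγ]; field_simp
    · ring
  have r0 : Real.exp (γ 0 * t) * (Real.exp (γ 0 * t) * z) ^ (lam 0 / γ 0 - 1) =
      Real.exp (lam 0 * t) * z ^ (lam 0 / γ 0 - 1) := by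
    rw [Real.mul_rpow (Real.exp_nonneg _) hz'.le, ← Real.exp_mul, ← mul_assoc, ← Real.exp_add]
    congr 2
    linear_combination t * hαγ
  have r2 : Real.exp (-((q + lam 0) * t)) = Real.exp (-(q * t)) * Real.exp (-(lam 0 * t)) := by
    rw [← Real.exp_add]; congr 1; ring
  have r3 : Real.exp (lam 0 * t) * Real.exp (-(lam 0 * t)) = 1 := by
    rw [← Real.exp_add, add_neg_cancel, Real.exp_zero]
  have r4 : Real.exp (-lam 1 * (Real.exp (γ 0 * t) * z)) =
      Real.exp (-(lam 1 * z * Real.exp (γ 0 * t))) := by congr 1; ring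
  simp only [hP, hg', profile, Matrix.cons_val_zero, Matrix.cons_val_one, ← hC]
  rw [r1, r2, r4]
  set w := z ^ (lam 0 / γ 0 - 1)
  set E := Real.exp (-(lam 1 * z * Real.exp (γ 0 * t)))
  linear_combination
    (q * C * E * Real.exp (-(q * t)) * Real.exp (-(lam 0 * t))) * r0 +
    (q * C * E * Real.exp (-(q * t)) * w + lam 1 * γ 0 * C * E * Real.exp (-(q * t)) *
      Real.exp (γ 0 * t) * w * z) * r3

/-- Balance of the profile under the motion in state `1`. -/
lemma profile_balance_one (hlam : ∀ i, 0 < lam i) (hγ0 : 0 < γ 0) {q : ℝ} (hq : 0 < q)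
    {H : ℝ → ℝ≥0∞} (hH : Measurable H) :
    ∫⁻ y in Ioi 0, ENNReal.ofReal (q * profile lam γ 1 y + lam 0 * profile lam γ 0 y) *
      ∫⁻ t in Ioi 0, ENNReal.ofReal (Real.exp (-((q + lam 1) * t))) * H (y + t) =
    ∫⁻ z in Ioi 0, ENNReal.ofReal (profile lam γ 1 z) * H z := by
  set P : ℝ → ℝ := fun y => q * profile lam γ 1 y + lam 0 * profile lam γ 0 y with hP
  have hp0 := measurable_profile (lam := lam) (γ := γ) 0
  have hp1 := measurable_profile (lam := lam) (γ := γ) 1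
  have hPm : Measurable P := by fun_prop
  have h1 : ∀ y, ENNReal.ofReal (P y) * ∫⁻ t in Ioi 0,
      ENNReal.ofReal (Real.exp (-((q + lam 1) * t))) * H (y + t) =
      ∫⁻ t in Ioi 0, ENNReal.ofReal (P y) * (ENNReal.ofReal (Real.exp (-((q + lam 1) * t))) *
        H (y + t)) := fun y =>
    (lintegral_const_mul _ (by fun_prop)).symm
  have h2 : ∀ t ∈ Ioi (0 : ℝ), ∫⁻ y in Ioi 0, ENNReal.ofReal (P y) *
      (ENNReal.ofReal (Real.exp (-((q + lam 1) * t))) * H (y + t)) =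
      ∫⁻ z in Ioi 0, (if t < z then ENNReal.ofReal (P (z - t) *
        Real.exp (-((q + lam 1) * t))) else 0) * H z := by
    intro t ht
    have ht' : 0 < t := ht
    rw [← lintegral_Ioi_shift t, ← max_eq_left ht'.le, ← Ioi_inter_Ioi,
      ← setLIntegral_indicator measurableSet_Ioi, max_eq_left ht'.le]
    refine lintegral_congr fun z => ?_
    by_cases h : t < z
    · rw [indicator_of_mem (mem_Ioi.2 h), if_pos h, sub_add_cancel,
        ENNReal.ofReal_mul' (Real.exp_nonneg _), mul_assoc]
    · rw [indicator_of_notMem (by simpa using h), if_neg h, zero_mul]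
  have hm2 : Measurable fun p : ℝ × ℝ => (if p.1 < p.2 then ENNReal.ofReal (P (p.2 - p.1) *
        Real.exp (-((q + lam 1) * p.1))) else 0) * H p.2 :=
    (Measurable.ite (measurableSet_lt measurable_fst measurable_snd) (by fun_prop)
      measurable_const).mul (by fun_prop)
  refine (lintegral_congr h1).trans ?_
  rw [lintegral_lintegral_swap (Measurable.aemeasurable (by fun_prop)),
    setLIntegral_congr_fun measurableSet_Ioi h2, lintegral_lintegral_swap hm2.aemeasurable]
  refine setLIntegral_congr_fun measurableSet_Ioi fun z hz => ?_
  have hz' : 0 < z := hz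
  rw [lintegral_mul_const _ (Measurable.ite measurableSet_Iio (by fun_prop) measurable_const)]
  congr 1
  set C := normConst lam (lam 0 / γ 0) with hC
  have hCpos : 0 < C := normConst_pos hlam (div_pos (hlam 0) hγ0)
  have hα : 0 < lam 0 / γ 0 := div_pos (hlam 0) hγ0
  -- `g t` is `-π₁(z - t) e^{-(q + λ₁) t}` simplified. It vanishes at `t = z` because `α > 0`, and
  -- equals `-π₁(z)` at `t = 0`.
  set g : ℝ → ℝ := fun t => -(γ 0 * C * Real.exp (-lam 1 * z) *
    (Real.exp (-(q * t)) * (z - t) ^ (lam 0 / γ 0))) with hg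
  set g' : ℝ → ℝ := fun t => C * Real.exp (-lam 1 * z) * (Real.exp (-(q * t)) *
    (q * γ 0 * (z - t) ^ (lam 0 / γ 0) + lam 0 * (z - t) ^ (lam 0 / γ 0 - 1))) with hg'
  have hcont : ContinuousOn g (Icc 0 z) := by
    have : Continuous fun t : ℝ => (z - t) ^ (lam 0 / γ 0) :=
      (continuous_const.sub continuous_id).rpow_const fun t => Or.inr hα.le
    exact Continuous.continuousOn (by fun_prop)
  have hαγ : γ 0 * (lam 0 / γ 0) = lam 0 := by field_simp
  have hd : ∀ t ∈ Ioo (0 : ℝ) z, HasDerivAt g (g' t) t := by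
    intro t ht
    have e1 : HasDerivAt (fun t => Real.exp (-(q * t))) (Real.exp (-(q * t)) * (-(q * 1))) t :=
      ((hasDerivAt_id t).const_mul q).neg.exp
    have e2 : HasDerivAt (fun t => (z - t) ^ (lam 0 / γ 0))
        (-1 * (lam 0 / γ 0) * (z - t) ^ (lam 0 / γ 0 - 1)) t :=
      ((hasDerivAt_id t).const_sub z).rpow_const (Or.inl (sub_pos.2 ht.2).ne')
    refine (((e1.mul e2).const_mul (γ 0 * C * Real.exp (-lam 1 * z))).neg).congr_deriv ?_
    simp only [hg']
    linear_combination (C * Real.exp (-lam 1 * z) * Real.exp (-(q * t)) *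
      (z - t) ^ (lam 0 / γ 0 - 1)) * hαγ
  have hpos : ∀ t ∈ Ioo (0 : ℝ) z, 0 ≤ g' t := by
    intro t ht
    have := hlam 0
    have := sub_pos.2 ht.2
    simp only [hg']
    positivity
  have key := lintegral_Ioo_of_hasDerivAt hz'.le hcont hd hpos
  have h0 : g z - g 0 = profile lam γ 1 z := by
    simp only [hg, profile, hC, sub_self, Real.zero_rpow hα.ne', mul_zero, neg_zero,
      Real.exp_zero, sub_zero, Matrix.cons_val_one]
    simp only [Matrix.cons_val_fin_one]
    ring
  rw [h0] at key
  rw [← key, ← Ioi_inter_Iio, inter_comm, ← setLIntegral_indicator measurableSet_Iio]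
  refine lintegral_congr fun t => ?_
  by_cases h : t < z
  · rw [if_pos h, indicator_of_mem (mem_Iio.2 h)]
    congr 1
    have r2 : Real.exp (-lam 1 * (z - t)) * Real.exp (-((q + lam 1) * t)) =
        Real.exp (-lam 1 * z) * Real.exp (-(q * t)) := by
      rw [← Real.exp_add, ← Real.exp_add]
      congr 1
      ring
    simp only [hP, hg', profile, Matrix.cons_val_zero, Matrix.cons_val_one, ← hC]
    linear_combination (C * (q * γ 0 * (z - t) ^ (lam 0 / γ 0) +
      lam 0 * (z - t) ^ (lam 0 / γ 0 - 1))) * r2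
  · rw [if_neg h, indicator_of_notMem (by simpa using h)]

/-! ### Total mass, and coordinates centred at the rest point -/

/-- The two Gamma integrals are `Γ(α) / λ₁^α` and `γ₀ Γ(α + 1) / λ₁^{α + 1} = λ₀ Γ(α) / λ₁^{α + 1}`;
their sum is the reciprocal of `normConst`. -/
lemma integral_profile_add (hlam : ∀ i, 0 < lam i) (hγ0 : 0 < γ 0) :
    (∀ i, IntegrableOn (profile lam γ i) (Ioi 0)) ∧
      ∫ y in Ioi 0, (profile lam γ 0 y + profile lam γ 1 y) = 1 := by
  set α := lam 0 / γ 0 with hα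
  have hαpos : 0 < α := div_pos (hlam 0) hγ0
  have hint : ∀ {s : ℝ}, 0 < s → ∫ y in Ioi 0, y ^ (s - 1) * Real.exp (-lam 1 * y) =
      (1 / lam 1) ^ s * Real.Gamma s := by
    intro s hs
    simpa using Real.integral_rpow_mul_exp_neg_mul_Ioi hs (hlam 1)
  have hintble : ∀ {s : ℝ}, 0 < s →
      IntegrableOn (fun y => y ^ (s - 1) * Real.exp (-lam 1 * y)) (Ioi 0) := by
    intro s hs
    -- A non-integrable function would have integral `0` by convention, but the Gamma value is
    -- positive.
    by_contra h
    have h1 := hint hs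
    rw [integral_undef h] at h1
    exact (mul_pos (Real.rpow_pos_of_pos (one_div_pos.2 (hlam 1)) s)
      (Real.Gamma_pos_of_pos hs)).ne h1
  have hi1 := hintble (show 0 < α + 1 by linarith)
  have hv1 := hint (show 0 < α + 1 by linarith)
  rw [add_sub_cancel_right] at hi1 hv1
  have e0 : profile lam γ 0 = fun y =>
      normConst lam α * (y ^ (α - 1) * Real.exp (-lam 1 * y)) := by
    ext y
    simp [profile, ← hα, mul_assoc]
  have e1 : profile lam γ 1 = fun y =>
      γ 0 * normConst lam α * (y ^ α * Real.exp (-lam 1 * y)) := by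
    ext y
    simp [profile, ← hα, mul_assoc]
  have i0 : IntegrableOn (profile lam γ 0) (Ioi 0) := by
    rw [e0]
    exact (hintble hαpos).const_mul _
  have i1 : IntegrableOn (profile lam γ 1) (Ioi 0) := by
    rw [e1]
    exact hi1.const_mul _
  refine ⟨fun i => ?_, ?_⟩
  · fin_cases i
    exacts [i0, i1]
  · rw [integral_add i0 i1, e0, e1, integral_const_mul, integral_const_mul, hint hαpos, hv1,
      Real.Gamma_add_one hαpos.ne', normConst]
    have hG := (Real.Gamma_pos_of_pos hαpos).ne'
    have hs := (add_pos (hlam 0) (hlam 1)).ne'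
    have hl1 := hlam 1
    have hr := (Real.rpow_pos_of_pos hl1 α).ne'
    have hγα : γ 0 * α = lam 0 := by rw [hα]; field_simp
    rw [one_div, Real.inv_rpow hl1.le, Real.inv_rpow hl1.le, Real.rpow_add hl1,
      Real.rpow_add hl1, Real.rpow_one]
    field_simp
    linear_combination hγα

lemma flow_zero (hγ0 : 0 < γ 0) (σ t y : ℝ) :
    flow a γ 0 t (a 0 / γ 0 + σ * y) = a 0 / γ 0 + σ * (Real.exp (-(γ 0 * t)) * y) := by
  have hd : ∀ s ∈ uIcc 0 t, HasDerivAt (fun s => a 0 / γ 0 * Real.exp (-(γ 0 * t - γ 0 * s)))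
      (a 0 * Real.exp (-(γ 0 * t - γ 0 * s))) s := by
    intro s _
    have e1 : HasDerivAt (fun s => -(γ 0 * t - γ 0 * s)) (-(-(γ 0 * 1))) s :=
      (((hasDerivAt_id s).const_mul (γ 0)).const_sub (γ 0 * t)).neg
    refine (e1.exp.const_mul (a 0 / γ 0)).congr_deriv ?_
    field_simp
  rw [flow, intervalIntegral.integral_eq_sub_of_hasDerivAt hd
    (Continuous.intervalIntegrable (by fun_prop) _ _)]
  simp only [sub_self, neg_zero, Real.exp_zero, mul_zero, sub_zero]
  ring

lemma flow_one (hγ1 : γ 1 = 0) (ρ t y : ℝ) :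
    flow a γ 1 t (ρ + a 1 * y) = ρ + a 1 * (y + t) := by
  simp [flow, hγ1]
  ring

/-- The motion `y ↦ ρ + σ y` with `σ = ± 1` preserves Lebesgue measure. -/
lemma measurePreserving_add_mul (ρ : ℝ) {σ : ℝ} (hσ : σ = 1 ∨ σ = -1) :
    MeasurePreserving (fun y : ℝ => ρ + σ * y) := by
  rcases hσ with rfl | rfl
  · simpa using measurePreserving_add_left (volume : Measure ℝ) ρ
  · simpa [sub_eq_add_neg] using Measure.measurePreserving_sub_left (volume : Measure ℝ) ρ

lemma measurableEmbedding_add_mul (ρ : ℝ) {σ : ℝ} (hσ : σ = 1 ∨ σ = -1) :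
    MeasurableEmbedding (fun y : ℝ => ρ + σ * y) := by
  refine Continuous.measurableEmbedding (by fun_prop) fun x y h => ?_
  have hσ0 : σ ≠ 0 := by rcases hσ with rfl | rfl <;> norm_num
  exact mul_left_cancel₀ hσ0 (add_left_cancel h)

/-- Writing the half-line as `0 < σ * (x - ρ)` treats both signs of `a 1` by one computation. -/
lemma explicitDensity_comp {σ : ℝ} (hσ : σ = 1 ∨ σ = -1) (i : Fin 2) (y : ℝ) :
    explicitDensity lam a γ {x | 0 < σ * (x - a 0 / γ 0)} i (a 0 / γ 0 + σ * y) =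
      (Ioi 0).indicator (profile lam γ i) y := by
  have h1 : σ * (σ * y) = y := by rcases hσ with rfl | rfl <;> ring
  by_cases hy : 0 < y
  · have h2 : |σ| * |y| = y := by rcases hσ with rfl | rfl <;> simp [abs_of_pos hy]
    fin_cases i <;> simp [explicitDensity, profile, indicator, h1, hy, abs_mul, h2]
  · fin_cases i <;> simp [explicitDensity, indicator, h1, hy]

theorem isInvariantDensity_explicitDensity (hlam : ∀ i, 0 < lam i) (hγ0 : 0 < γ 0)
    (hγ1 : γ 1 = 0) (hσ : a 1 = 1 ∨ a 1 = -1) :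
    IsInvariantDensity lam a γ
      (explicitDensity lam a γ {x | 0 < a 1 * (x - a 0 / γ 0)}) := by
  set ρ := a 0 / γ 0 with hρ
  set φ : ℝ → ℝ := fun y => ρ + a 1 * y with hφ
  have hmp : MeasurePreserving φ := measurePreserving_add_mul ρ hσ
  have hemb : MeasurableEmbedding φ := measurableEmbedding_add_mul ρ hσ
  set π := explicitDensity lam a γ {x | 0 < a 1 * (x - ρ)} with hπ
  have hcomp : ∀ i y, π i (φ y) = (Ioi 0).indicator (profile lam γ i) y :=
    explicitDensity_comp hσ
  have hcomp' : ∀ i, π i ∘ φ = (Ioi 0).indicator (profile lam γ i) := fun i => funext (hcomp i)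
  obtain ⟨hpi, hp1⟩ := integral_profile_add hlam hγ0
  have hsurj : ∀ x, ∃ y, φ y = x := by
    intro x
    -- Since `a 1 = ± 1`, it is its own inverse.
    refine ⟨a 1 * (x - ρ), ?_⟩
    simp only [hφ]
    rcases hσ with h | h <;> rw [h] <;> ring
  have hnonneg : ∀ i x, 0 ≤ π i x := by
    intro i x
    obtain ⟨y, rfl⟩ := hsurj x
    rw [hcomp]
    exact indicator_nonneg (fun y hy => profile_nonneg hlam hγ0 i hy) y
  have hint : ∀ i, Integrable (π i) := by
    intro i
    rw [← hmp.integrable_comp_emb hemb, hcomp', integrable_indicator_iff measurableSet_Ioi]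
    exact hpi i
  have hone : ∫ x, (π 0 x + π 1 x) = 1 := by
    rw [← hmp.integral_comp hemb]
    simp only [hcomp]
    rw [← hp1, ← integral_indicator measurableSet_Ioi]
    refine integral_congr_ae (Eventually.of_forall fun y => ?_)
    by_cases hy : 0 < y <;> simp [indicator, hy]
  have hprob := isProbabilityMeasure_densityMeasure hnonneg hint hone
  set m : Fin 2 → Measure ℝ := fun i => volume.withDensity fun x => ENNReal.ofReal (π i x) with hm
  have hmfin : ∀ i, IsFiniteMeasure (m i) := fun i =>
    isFiniteMeasure_withDensity (hint i).lintegral_lt_top.ne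
  have hlin : ∀ i, ∀ f : ℝ → ℝ≥0∞, Measurable f → ∫⁻ x, f x ∂m i =
      ∫⁻ x, ENNReal.ofReal (π i x) * f x := by
    intro i f hf
    rw [hm, lintegral_withDensity_eq_lintegral_mul₀ (hint i).aemeasurable.ennreal_ofReal
      hf.aemeasurable]
    rfl
  have hlin' : ∀ i, ∀ f : ℝ → ℝ≥0∞, Measurable f → ∫⁻ x, f x ∂m i =
      ∫⁻ y in Ioi 0, ENNReal.ofReal (profile lam γ i y) * f (φ y) := by
    intro i f hf
    rw [hlin i f hf, ← hmp.lintegral_comp_emb hemb, ← lintegral_indicator measurableSet_Ioi]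
    refine lintegral_congr fun y => ?_
    rw [hcomp]
    by_cases hy : 0 < y <;> simp [indicator, hy]
  refine ⟨hnonneg, hint, hone, isInvariant_of_killedResolvent hlam (m := m) ?_ ?_⟩
  · intro f hf
    rw [lintegral_densityMeasure (fun i => (hint i).aemeasurable) hf]
    exact Finset.sum_congr rfl fun i _ => (hlin i _ (hf.comp measurable_prodMk_right)).symm
  · intro q hq i h hh
    have hK := measurable_killedResolvent (lam := lam) (a := a) (γ := γ) q i hh
    have hKφ : Measurable fun y => killedResolvent lam a γ q i h (φ y) :=
      hK.comp hmp.measurable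
    have hsum : ∀ j, ENNReal.ofReal q * ∫⁻ x, killedResolvent lam a γ q i h x ∂m i +
        ENNReal.ofReal (lam j) * ∫⁻ x, killedResolvent lam a γ q i h x ∂m j =
        ∫⁻ y in Ioi 0, ENNReal.ofReal (q * profile lam γ i y + lam j * profile lam γ j y) *
          killedResolvent lam a γ q i h (φ y) := by
      intro j
      have hpm : ∀ j, Measurable fun y => ENNReal.ofReal (profile lam γ j y) *
          killedResolvent lam a γ q i h (φ y) := fun j =>
        (measurable_profile j).ennreal_ofReal.mul hKφ
      rw [hlin' i _ hK, hlin' j _ hK, ← lintegral_const_mul _ (hpm i),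
        ← lintegral_const_mul _ (hpm j), ← lintegral_add_left ((hpm i).const_mul _)]
      refine setLIntegral_congr_fun measurableSet_Ioi fun y hy => ?_
      have n1 := profile_nonneg hlam hγ0 i hy
      have n2 := profile_nonneg hlam hγ0 j hy
      rw [ENNReal.ofReal_add (mul_nonneg hq.le n1) (mul_nonneg (hlam j).le n2),
        ENNReal.ofReal_mul hq.le, ENNReal.ofReal_mul (hlam j).le]
      ring
    rw [hsum, hlin' i h hh]
    have hhφ : Measurable fun y => h (φ y) := hh.comp hmp.measurable
    obtain rfl | rfl : i = 0 ∨ i = 1 := by omega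
    · rw [← profile_balance_zero hlam hγ0 hq hhφ]
      simp only [killedResolvent, hφ]
      simp only [hρ, flow_zero hγ0]
      rfl
    · rw [← profile_balance_one hlam hγ0 hq hhφ]
      simp only [killedResolvent, hφ]
      simp only [flow_one hγ1]
      rfl

theorem isInvariantDensity_unique (hlam : ∀ i, 0 < lam i) (hγ0 : 0 < γ 0) (hγ : ∀ i, 0 ≤ γ i)
    {π π' : Fin 2 → ℝ → ℝ} (h : IsInvariantDensity lam a γ π)
    (h' : IsInvariantDensity lam a γ π') (i : Fin 2) : π i =ᵐ[volume] π' i := by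
  have := h.isProbabilityMeasure
  have := h'.isProbabilityMeasure
  exact ae_eq_of_densityMeasure_eq h.nonneg h.integrable h'.nonneg h'.integrable
    (invariant_unique hlam hγ0 hγ h.invariant h'.invariant) i

end

end KacOU

/-! ### The three values of `a 1` -/

theorem mainTheorem5 (lam a γ : Fin 2 → ℝ) (hlam : ∀ i, 0 < lam i)
    (hγ0 : 0 < γ 0) (hγ1 : γ 1 = 0) :
    (a 1 = 1 →
      KacOU.IsInvariantDensity lam a γ
          (KacOU.explicitDensity lam a γ (Set.Ioi (a 0 / γ 0))) ∧
        ∀ π : Fin 2 → ℝ → ℝ, KacOU.IsInvariantDensity lam a γ π →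
          ∀ i, π i =ᵐ[volume]
            KacOU.explicitDensity lam a γ (Set.Ioi (a 0 / γ 0)) i) ∧
    (a 1 = -1 →
      KacOU.IsInvariantDensity lam a γ
          (KacOU.explicitDensity lam a γ (Set.Iio (a 0 / γ 0))) ∧
        ∀ π : Fin 2 → ℝ → ℝ, KacOU.IsInvariantDensity lam a γ π →
          ∀ i, π i =ᵐ[volume]
            KacOU.explicitDensity lam a γ (Set.Iio (a 0 / γ 0)) i) ∧
    (a 1 = 0 →
      (¬ ∃ π : Fin 2 → ℝ → ℝ, KacOU.IsInvariantDensity lam a γ π) ∧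
        ∀ μ : Measure (ℝ × Fin 2), IsProbabilityMeasure μ → KacOU.IsInvariant lam a γ μ →
          μ {z | z.1 ≠ a 0 / γ 0} = 0) := by
  have hγ : ∀ i, 0 ≤ γ i := by
    intro i
    fin_cases i
    exacts [hγ0.le, hγ1.ge]
  refine ⟨fun ha => ?_, fun ha => ?_, fun ha => ?_⟩
  · have hK : {x : ℝ | 0 < a 1 * (x - a 0 / γ 0)} = Set.Ioi (a 0 / γ 0) := by
      ext x; simp [ha]
    have h := KacOU.isInvariantDensity_explicitDensity hlam hγ0 hγ1 (Or.inl ha)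
    rw [hK] at h
    exact ⟨h, fun π hπ => KacOU.isInvariantDensity_unique hlam hγ0 hγ hπ h⟩
  · have hK : {x : ℝ | 0 < a 1 * (x - a 0 / γ 0)} = Set.Iio (a 0 / γ 0) := by
      ext x; simp [ha]
    have h := KacOU.isInvariantDensity_explicitDensity hlam hγ0 hγ1 (Or.inr ha)
    rw [hK] at h
    exact ⟨h, fun π hπ => KacOU.isInvariantDensity_unique hlam hγ0 hγ hπ h⟩
  -- State `1` does not move at all here, so `ρ` is a common zero of both velocity fields.
  · have hrest : ∀ i, a i = γ i * (a 0 / γ 0) := by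
      intro i
      fin_cases i
      · show a 0 = γ 0 * (a 0 / γ 0)
        field_simp
      · simp [ha, hγ1]
    exact ⟨KacOU.not_exists_isInvariantDensity hlam hγ0 hγ hrest, fun μ _ hμ =>
      KacOU.invariant_concentrated hlam hγ0 hγ hrest hμ⟩
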